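/- Let $k$ be a commutative ring; all DG categories and DG functors are over $k$. **Conventions.** For a DG category $\mathbf A$, $\mathrm{Perf}(\mathbf A)$ is the DG category of those DG modules over $\mathbf A$ that are, up to homotopy, direct summands of finitely generated semi-free DG modules; $\mathbf A$ is regarded as a full DG subcategory of $\mathrm{Perf}(\mathbf A)$ by the Yoneda embedding. $\mathbf A$ is *pretriangulated* if every finitely generated semi-free DG module over it is homotopy equivalent to a representable one. An *enhancement* of a triangulated category $\mathcal C$ is a pretriangulated DG category $\mathbf C$ with an equivalence of triangulated categories $\epsilon\colon H^0(\mathbf C)\to\mathcal C$. A DG functor is a *quasi-equivalence* if it induces isomorphisms on the cohomology of all Hom complexes and $H^0$ of it is essentially surjective. $\mathcal C^\natural$ is the idempotent completion of $\mathcal C$, and $M^\natural$ is the extension of a monad $M$ on $\mathcal C$ to $\mathcal C^\natural$. $M\text{-Mod}$ is the Eilenberg–Moore category of modules over $M$; it is a full subcategory of $M^\natural\text{-Mod}$. **Setup.** Let $M$ be an exact monad on a triangulated category $\mathcal C$. Let $(\mathbf C,\epsilon)$ be an enhancement of $\mathcal C$, let $\mathbf M$ be a DG monad on $\mathbf C$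 lifting $M$ (that is, $\epsilon\circ H^0(\mathbf M)\cong M\circ\epsilon$ compatibly with units and multiplications), and let $\mathrm{Perf}(\mathbf M)$ be a DG monad on $\mathrm{Perf}(\mathbf C)$ that in the same sense lifts $\mathbf M$ (up to DG isomorphism). Let $\mathbf E$ be a pretriangulated DG category with a DG adjunction $F\colon\mathrm{Perf}(\mathbf C)\rightleftarrows\mathbf E\colon G$, $F\dashv G$, and an isomorphism of DG monads $GF\cong\mathrm{Perf}(\mathbf M)$. Identifying the idempotent completions of $H^0(\mathrm{Perf}(\mathbf C))$, $H^0(\mathbf C)$ and $\mathcal C$, one gets a comparison functor $\Phi\colon H^0(\mathbf E)\to M^\natural\text{-Mod}$, $e\mapsto(Ge,\,G\varepsilon_e)$, where $\varepsilon$ is the counit. Assume that $\Phi$ is an equivalence (so $\mathbf E$ enhances $M^\natural\text{-Mod}$). Let $\mathbf Q(\mathbf C,\mathbf E)\subseteq\mathbf E$ be the full DG subcategory of all objects $e$ such that $Ge$ is isomorphic in $H^0(\mathrm{Perf}(\mathbf C))$ to an object of $\mathbf C$. Let $\mathcal C',M',\mathbf C',\mathbf M',\mathbf E',F',G',\Phi'$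 be a second such setup. **Morphism.** Let $C\colon\mathbf C\to\mathbf C'$ and $E\colon\mathbf E\to\mathbf E'$ be DG functors that induce a morphism $\varphi$ of adjoint pairs from $(F,G)$ to $(F',G')$. That is, for a DG functor $\mathrm{Perf}(C)\colon\mathrm{Perf}(\mathbf C)\to\mathrm{Perf}(\mathbf C')$ that extends $C$ up to DG isomorphism, there are given DG isomorphisms $F'\circ\mathrm{Perf}(C)\cong E\circ F$ and $G'\circ E\cong\mathrm{Perf}(C)\circ G$ compatible with the units and counits of the two adjunctions. Then $E$ restricts to a DG functor $\mathbf Q(\varphi)\colon\mathbf Q(\mathbf C,\mathbf E)\to\mathbf Q(\mathbf C',\mathbf E')$, and $\varphi$ and $C$ induce a functor $C_*\colon M\text{-Mod}\to M'\text{-Mod}$. **Proposition.** 1. There is a functor $\Gamma\colon H^0(\mathbf Q(\mathbf C,\mathbf E))\to M\text{-Mod}$ whose composite with $M\text{-Mod}\hookrightarrow M^\natural\text{-Mod}$ is isomorphic to the restriction of $\Phi$, and every such $\Gamma$ is an equivalence. The same holds for $\Gamma'\colon H^0(\mathbf Q(\mathbf C',\mathbf E'))\to M'\text{-Mod}$ and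 $\Phi'$. 2. For all such $\Gamma$ and $\Gamma'$ there is an isomorphism of functors $C_*\circ\Gamma\cong\Gamma'\circ H^0(\mathbf Q(\varphi))$. 3. If $C$ and $E$ are quasi-equivalences, then $\mathbf Q(\varphi)$ is a quasi-equivalence. -/

import Mathlib

open CategoryTheory

/-- A (small) DG category over `k`, with cohomological grading.  `comp h f g` is the composition
"first `f`, then `g`"; the Leibniz rule is `d (g ∘ f) = (d g) ∘ f + (-1)^|g| g ∘ (d f)`. -/
structure DGCat.{w, u, v} (k : Type w) [CommRing k] where
  Obj : Type u
  Hom : Obj → Obj → ℤ → Type v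
  [addCommGroup : ∀ X Y n, AddCommGroup (Hom X Y n)]
  [module : ∀ X Y n, Module k (Hom X Y n)]
  d : ∀ {X Y : Obj} {n m : ℤ}, n + 1 = m → (Hom X Y n →ₗ[k] Hom X Y m)
  comp : ∀ {X Y Z : Obj} {a b c : ℤ}, a + b = c →
    (Hom X Y a →ₗ[k] Hom Y Z b →ₗ[k] Hom X Z c)
  id : ∀ X : Obj, Hom X X 0
  d_d : ∀ {X Y : Obj} {n m l : ℤ} (h : n + 1 = m) (h' : m + 1 = l) (f : Hom X Y n),
    d h' (d h f) = 0
  d_comp : ∀ {X Y Z : Obj} {a b c a' b' c' : ℤ} (h : a + b = c) (ha : a + 1 = a')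
    (hb : b + 1 = b') (hc : c + 1 = c') (h₁ : a + b' = c') (h₂ : a' + b = c')
    (f : Hom X Y a) (g : Hom Y Z b),
    d hc (comp h f g) = comp h₁ f (d hb g) + b.negOnePow • comp h₂ (d ha f) g
  id_comp : ∀ {X Y : Obj} {n : ℤ} (h : 0 + n = n) (f : Hom X Y n), comp h (id X) f = f
  comp_id : ∀ {X Y : Obj} {n : ℤ} (h : n + 0 = n) (f : Hom X Y n), comp h f (id Y) = f
  assoc : ∀ {X Y Z W : Obj} {a b c ab bc abc : ℤ} (h : a + b = ab) (h' : ab + c = abc)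
    (h₁ : b + c = bc) (h₂ : a + bc = abc) (f : Hom X Y a) (g : Hom Y Z b) (l : Hom Z W c),
    comp h' (comp h f g) l = comp h₂ f (comp h₁ g l)

attribute [instance] DGCat.addCommGroup DGCat.module

namespace DGCat

variable {k : Type*} [CommRing k]

lemma d_id (A : DGCat k) (X : A.Obj) {m : ℤ} (h : 0 + 1 = m) : A.d h (A.id X) = 0 := by
  have h1 := A.d_comp (add_zero 0) h h h (by omega) (by omega) (A.id X) (A.id X)
  subst h
  rw [A.id_comp, A.id_comp, A.comp_id] at h1
  simpa using h1

/-- An element of a Hom complex is a boundary. -/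
def IsBoundary (A : DGCat k) {X Y : A.Obj} {n : ℤ} (f : A.Hom X Y n) : Prop :=
  ∃ (m : ℤ) (h : m + 1 = n) (g : A.Hom X Y m), A.d h g = f

/-- An element of a Hom complex is a cycle. -/
def IsClosed (A : DGCat k) {X Y : A.Obj} {n : ℤ} (f : A.Hom X Y n) : Prop :=
  A.d (rfl : n + 1 = n + 1) f = 0

lemma IsClosed.d_eq {A : DGCat k} {X Y : A.Obj} {n m : ℤ} {f : A.Hom X Y n} (hf : A.IsClosed f)
    (h : n + 1 = m) : A.d h f = 0 := by
  subst h; exact hf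

lemma IsClosed.comp {A : DGCat k} {X Y Z : A.Obj} {a b c : ℤ} (h : a + b = c)
    {f : A.Hom X Y a} {g : A.Hom Y Z b} (hf : A.IsClosed f) (hg : A.IsClosed g) :
    A.IsClosed (A.comp h f g) := by
  have := A.d_comp h rfl rfl (rfl : c + 1 = c + 1) (by omega) (by omega) f g
  rw [IsClosed, this, hf.d_eq, hg.d_eq]
  simp

lemma IsBoundary.comp_left {A : DGCat k} {X Y Z : A.Obj} {a b c : ℤ} (h : a + b = c)
    {f : A.Hom X Y a} {g : A.Hom Y Z b} (hf : A.IsClosed f) (hg : A.IsBoundary g) :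
    A.IsBoundary (A.comp h f g) := by
  obtain ⟨m, hm, t, rfl⟩ := hg
  refine ⟨c - 1, by omega, A.comp (by omega) f t, ?_⟩
  have := A.d_comp (by omega : a + m = c - 1) rfl hm (by omega : c - 1 + 1 = c) h (by omega) f t
  rw [this, hf.d_eq]
  simp

lemma IsBoundary.comp_right {A : DGCat k} {X Y Z : A.Obj} {a b c : ℤ} (h : a + b = c)
    {f : A.Hom X Y a} {g : A.Hom Y Z b} (hf : A.IsBoundary f) (hg : A.IsClosed g) :
    A.IsBoundary (A.comp h f g) := by
  obtain ⟨m, hm, t, rfl⟩ := hf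
  refine ⟨c - 1, by omega, b.negOnePow • A.comp (by omega) t g, ?_⟩
  have := A.d_comp (by omega : m + b = c - 1) hm rfl (by omega : c - 1 + 1 = c) (by omega) h t g
  rw [map_zsmul_unit, this, hg.d_eq]
  simp [smul_smul]

/-! ### The categories `Z⁰` and `H⁰` -/

/-- The objects of `Z⁰(A)`. -/
structure Z0 (A : DGCat k) where
  as : A.Obj

/-- The morphisms of `Z⁰(A)`: closed morphisms of degree `0`. -/
@[ext]
structure Z0Hom (A : DGCat k) (X Y : A.Obj) where
  val : A.Hom X Y 0
  closed : A.IsClosed val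

instance (A : DGCat k) : Category A.Z0 where
  Hom X Y := A.Z0Hom X.as Y.as
  id X := ⟨A.id X.as, A.d_id X.as _⟩
  comp f g := ⟨A.comp (add_zero 0) f.val g.val, f.closed.comp _ g.closed⟩
  id_comp f := Z0Hom.ext (A.id_comp _ f.val)
  comp_id f := Z0Hom.ext (A.comp_id _ f.val)
  assoc f g h := Z0Hom.ext (A.assoc _ _ _ _ f.val g.val h.val)

@[simp] lemma Z0.comp_val {A : DGCat k} {X Y Z : A.Z0} (f : X ⟶ Y) (g : Y ⟶ Z) :
    (f ≫ g).val = A.comp (add_zero 0) f.val g.val := rfl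

@[simp] lemma Z0.id_val {A : DGCat k} (X : A.Z0) : Z0Hom.val (𝟙 X) = A.id X.as := rfl

@[ext] lemma Z0.hom_ext {A : DGCat k} {X Y : A.Z0} {f g : X ⟶ Y} (h : f.val = g.val) : f = g :=
  Z0Hom.ext h

/-- Two closed morphisms of degree `0` are homotopic if they differ by a boundary. -/
def homotopic (A : DGCat k) : HomRel A.Z0 := fun _ _ f g => A.IsBoundary (f.val - g.val)

instance (A : DGCat k) : Congruence A.homotopic where
  equivalence :=
    { refl := fun f => ⟨-1, by omega, 0, by simp⟩
      symm := by
        rintro f g ⟨m, h, t, ht⟩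
        exact ⟨m, h, -t, by rw [map_neg, ht, neg_sub]⟩
      trans := by
        rintro f g l ⟨m, h, t, ht⟩ ⟨m', h', t', ht'⟩
        obtain rfl : m = m' := by omega
        exact ⟨m, h, t + t', by rw [map_add, ht, ht', sub_add_sub_cancel]⟩ }
  comp_left f g g' h := by
    have := IsBoundary.comp_left (add_zero 0) f.closed h
    rwa [map_sub] at this
  comp_right {_ _ _ f f'} g h := by
    have := IsBoundary.comp_right (add_zero 0) h g.closed
    rwa [map_sub, LinearMap.sub_apply] at this

/-- The homotopy category `H⁰(A)`: same objects, morphisms `H⁰(Hom(X, Y))`. -/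
abbrev H0 (A : DGCat k) := CategoryTheory.Quotient A.homotopic

/-- The functor `Z⁰(A) ⥤ H⁰(A)` sending a closed morphism of degree `0` to its class. -/
abbrev toH0 (A : DGCat k) : A.Z0 ⥤ A.H0 := CategoryTheory.Quotient.functor A.homotopic

/-- An object of `A`, regarded as an object of `H⁰(A)`. -/
abbrev h0 (A : DGCat k) (X : A.Obj) : A.H0 := A.toH0.obj ⟨X⟩

/-- The full DG subcategory on the objects satisfying `p`. -/
abbrev full (A : DGCat k) (p : A.Obj → Prop) : DGCat k where
  Obj := { X : A.Obj // p X }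
  Hom X Y n := A.Hom X.1 Y.1 n
  d h := A.d h
  comp h := A.comp h
  id X := A.id X.1
  d_d := A.d_d
  d_comp := A.d_comp
  id_comp := A.id_comp
  comp_id := A.comp_id
  assoc := A.assoc

end DGCat

/-- A DG functor. -/
structure DGFunctor {k : Type*} [CommRing k] (A B : DGCat k) where
  obj : A.Obj → B.Obj
  map : ∀ {X Y : A.Obj} {n : ℤ}, A.Hom X Y n →ₗ[k] B.Hom (obj X) (obj Y) n
  map_d : ∀ {X Y : A.Obj} {n m : ℤ} (h : n + 1 = m) (f : A.Hom X Y n),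
    map (A.d h f) = B.d h (map f)
  map_id : ∀ X : A.Obj, map (A.id X) = B.id (obj X)
  map_comp : ∀ {X Y Z : A.Obj} {a b c : ℤ} (h : a + b = c) (f : A.Hom X Y a) (g : A.Hom Y Z b),
    map (A.comp h f g) = B.comp h (map f) (map g)

namespace DGFunctor

variable {k : Type*} [CommRing k] {A B D : DGCat k}

/-- The identity DG functor. -/
protected def id (A : DGCat k) : DGFunctor A A where
  obj X := X
  map := LinearMap.id
  map_d _ _ := rfl
  map_id _ := rfl
  map_comp _ _ _ := rfl

/-- Composition of DG functors: first `F`, then `G`. -/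
def comp (F : DGFunctor A B) (G : DGFunctor B D) : DGFunctor A D where
  obj X := G.obj (F.obj X)
  map := G.map ∘ₗ F.map
  map_d h f := by simp [F.map_d, G.map_d]
  map_id X := by simp [F.map_id, G.map_id]
  map_comp h f g := by simp [F.map_comp, G.map_comp]

/-- The inclusion of a full DG subcategory. -/
def fullIncl (A : DGCat k) (p : A.Obj → Prop) : DGFunctor (A.full p) A where
  obj X := X.1
  map := LinearMap.id
  map_d _ _ := rfl
  map_id _ := rfl
  map_comp _ _ _ := rfl

/-- A DG functor with values in a full DG subcategory. -/
def fullLift {p : B.Obj → Prop} (F : DGFunctor A B) (hF : ∀ X, p (F.obj X)) :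
    DGFunctor A (B.full p) where
  obj X := ⟨F.obj X, hF X⟩
  map := F.map
  map_d := F.map_d
  map_id := F.map_id
  map_comp := F.map_comp

lemma map_isClosed (F : DGFunctor A B) {X Y : A.Obj} {n : ℤ} {f : A.Hom X Y n}
    (hf : A.IsClosed f) : B.IsClosed (F.map f) := by
  rw [DGCat.IsClosed, ← F.map_d, hf.d_eq, map_zero]

lemma map_isBoundary (F : DGFunctor A B) {X Y : A.Obj} {n : ℤ} {f : A.Hom X Y n}
    (hf : A.IsBoundary f) : B.IsBoundary (F.map f) := by
  obtain ⟨m, h, g, rfl⟩ := hf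
  exact ⟨m, h, F.map g, (F.map_d h g).symm⟩

/-- The functor induced on `Z⁰`. -/
@[simps]
def mapZ0 (F : DGFunctor A B) : A.Z0 ⥤ B.Z0 where
  obj X := ⟨F.obj X.as⟩
  map f := ⟨F.map f.val, F.map_isClosed f.closed⟩
  map_id X := DGCat.Z0Hom.ext (F.map_id X.as)
  map_comp f g := DGCat.Z0Hom.ext (F.map_comp _ f.val g.val)

/-- The functor `H⁰(F)`. -/
def mapH0 (F : DGFunctor A B) : A.H0 ⥤ B.H0 :=
  CategoryTheory.Quotient.lift _ (F.mapZ0 ⋙ B.toH0) fun _ _ f g h => CategoryTheory.Quotient.sound _ (by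
    have := F.map_isBoundary h
    rwa [map_sub] at this)

/-- A DG functor is a quasi-equivalence if it induces isomorphisms on the cohomology of the Hom
complexes and `H⁰(F)` is essentially surjective. -/
structure IsQuasiEquivalence (F : DGFunctor A B) : Prop where
  inj : ∀ {X Y : A.Obj} {n : ℤ} (f : A.Hom X Y n), A.IsClosed f → B.IsBoundary (F.map f) →
    A.IsBoundary f
  surj : ∀ {X Y : A.Obj} {n : ℤ} (g : B.Hom (F.obj X) (F.obj Y) n), B.IsClosed g →
    ∃ f : A.Hom X Y n, A.IsClosed f ∧ B.IsBoundary (F.map f - g)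
  essSurj : F.mapH0.EssSurj

end DGFunctor

/-- A DG natural transformation: closed components of degree `0`, natural with respect to
morphisms of every degree. -/
structure DGNatTrans {k : Type*} [CommRing k] {A B : DGCat k} (F G : DGFunctor A B) where
  app : ∀ X : A.Obj, F.mapZ0.obj ⟨X⟩ ⟶ G.mapZ0.obj ⟨X⟩
  naturality : ∀ {X Y : A.Obj} {n : ℤ} (f : A.Hom X Y n),
    B.comp (add_zero n) (F.map f) (app Y).val = B.comp (zero_add n) (app X).val (G.map f)

/-- A DG natural isomorphism. -/
structure DGNatIso {k : Type*} [CommRing k] {A B : DGCat k} (F G : DGFunctor A B) where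
  app : ∀ X : A.Obj, F.mapZ0.obj ⟨X⟩ ≅ G.mapZ0.obj ⟨X⟩
  naturality : ∀ {X Y : A.Obj} {n : ℤ} (f : A.Hom X Y n),
    B.comp (add_zero n) (F.map f) (app Y).hom.val = B.comp (zero_add n) (app X).hom.val (G.map f)

/-! ### Monads and their categories of modules -/

section Monads

open Idempotents

variable {A B D : Type*} [Category* A] [Category* B] [Category* D]

/-- A (pseudo-)morphism of monads over a functor `K`: an isomorphism `T K ≅ K S` compatible with
units and multiplications. -/
structure MonadMap (S : Monad A) (T : Monad B) (K : A ⥤ B) where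
  iso : ∀ X : A, T.obj (K.obj X) ≅ K.obj (S.obj X)
  naturality : ∀ {X Y : A} (f : X ⟶ Y),
    T.map (K.map f) ≫ (iso Y).hom = (iso X).hom ≫ K.map (S.map f)
  unit : ∀ X : A, T.η.app (K.obj X) ≫ (iso X).hom = K.map (S.η.app X)
  mul : ∀ X : A, T.μ.app (K.obj X) ≫ (iso X).hom =
    T.map (iso X).hom ≫ (iso (S.obj X)).hom ≫ K.map (S.μ.app X)

namespace MonadMap

variable {S : Monad A} {T : Monad B} {R : Monad D} {K : A ⥤ B} {L : B ⥤ D}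

/-- The functor on modules, `(x, a) ↦ (K x, T K x ≅ K S x ⟶ K x)`. -/
def modMap (φ : MonadMap S T K) : S.Algebra ⥤ T.Algebra where
  obj X :=
    { A := K.obj X.A
      a := (φ.iso X.A).hom ≫ K.map X.a
      unit := by rw [← Category.assoc, φ.unit, ← K.map_comp, X.unit]; exact K.map_id _
      assoc := by
        have h := φ.mul X.A
        rw [← Category.assoc, h, T.map_comp, Category.assoc, Category.assoc, Category.assoc,
          ← K.map_comp, X.assoc, K.map_comp, ← Category.assoc (T.map (K.map X.a)),
          φ.naturality, Category.assoc] }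
  map f :=
    { f := K.map f.f
      h := by
        dsimp only
        rw [← Category.assoc, φ.naturality, Category.assoc, ← K.map_comp, f.h, K.map_comp,
          Category.assoc] }
  map_id X := by ext; exact K.map_id _
  map_comp f g := by ext; exact K.map_comp _ _

/-- Composition of morphisms of monads. -/
def comp (φ : MonadMap S T K) (ψ : MonadMap T R L) : MonadMap S R (K ⋙ L) where
  iso X := ψ.iso (K.obj X) ≪≫ L.mapIso (φ.iso X)
  naturality f := by
    have := ψ.naturality (K.map f)
    simp only [Functor.comp_obj, Functor.comp_map, Iso.trans_hom, Functor.mapIso_hom]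
    rw [← Category.assoc, this, Category.assoc, ← L.map_comp, φ.naturality, L.map_comp,
      Category.assoc]
  unit X := by
    simp only [Functor.comp_obj, Functor.comp_map, Iso.trans_hom, Functor.mapIso_hom]
    rw [← Category.assoc, ψ.unit, ← L.map_comp, φ.unit]
  mul X := by
    have h₁ := ψ.mul (K.obj X)
    have h₂ := ψ.naturality (φ.iso X).hom
    simp only [Functor.comp_obj, Functor.comp_map, Iso.trans_hom, Functor.mapIso_hom,
      Functor.map_comp, Category.assoc]
    rw [← Category.assoc, h₁, Category.assoc, Category.assoc, ← L.map_comp, φ.mul,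
      ← Category.assoc (R.map (L.map _)), h₂]
    simp only [L.map_comp, Category.assoc]

instance (φ : MonadMap S T K) [K.Faithful] : φ.modMap.Faithful where
  map_injective {X Y f g} h := by
    ext
    exact K.map_injective (congrArg Monad.Algebra.Hom.f h)

instance (φ : MonadMap S T K) [K.Full] [K.Faithful] : φ.modMap.Full where
  map_surjective {X Y} g := by
    obtain ⟨f, hf⟩ := K.map_surjective (X := X.A) (Y := Y.A) g.f
    have h : T.map (K.map f) ≫ (φ.iso Y.A).hom ≫ K.map Y.a =
        ((φ.iso X.A).hom ≫ K.map X.a) ≫ K.map f := by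
      rw [hf]; exact g.h
    refine ⟨⟨f, K.map_injective ?_⟩, ?_⟩
    · rw [K.map_comp, K.map_comp, ← cancel_epi (φ.iso X.A).hom, ← Category.assoc,
        ← φ.naturality, Category.assoc, h, Category.assoc]
    · ext
      exact hf

instance (φ : MonadMap S T K) [K.IsEquivalence] : φ.modMap.IsEquivalence where
  essSurj := ⟨fun Y => by
    let e : K.obj (K.objPreimage Y.A) ≅ Y.A := K.objObjPreimageIso Y.A
    let X := K.objPreimage Y.A
    let a : S.obj X ⟶ X := K.preimage ((φ.iso X).inv ≫ T.map e.hom ≫ Y.a ≫ e.inv)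
    have ha : (φ.iso X).hom ≫ K.map a = T.map e.hom ≫ Y.a ≫ e.inv := by
      simp [a]
    have hTa : T.map (φ.iso X).hom ≫ T.map (K.map a) =
        T.map (T.map e.hom) ≫ T.map Y.a ≫ T.map e.inv := by
      rw [← T.map_comp, ha]; simp
    refine ⟨⟨X, a, K.map_injective ?_, K.map_injective ?_⟩, ⟨Monad.Algebra.isoMk e ?_⟩⟩
    · have h₂ := T.η.naturality e.hom
      dsimp at h₂
      rw [K.map_comp, ← φ.unit, Category.assoc, ha, ← Category.assoc, ← h₂, Category.assoc,
        ← Category.assoc (T.η.app _), Y.unit]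
      simp [e]
    · have h₂ := T.μ.naturality e.hom
      have h₃ := φ.naturality a
      dsimp at h₂
      have h₄ := φ.mul X
      rw [← cancel_epi (φ.iso (S.obj X)).hom, ← cancel_epi (T.map (φ.iso X).hom),
        K.map_comp, K.map_comp, ← reassoc_of% h₃, ha, reassoc_of% hTa, ← reassoc_of% h₄, ha,
        ← reassoc_of% h₂, Y.assoc_assoc, ← T.map_comp_assoc e.inv, e.inv_hom_id, T.map_id,
        Category.id_comp]
    · dsimp [modMap]
      rw [ha]
      simp⟩

/-- Let `φ' : S' → T'` and `φ : S → T` be morphisms of monads over fully faithful functors, `P` a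
morphism from `T` to `T'`, and `ρ` an isomorphism showing that `P` restricts to a functor `C`.
Then `C` underlies a morphism of monads from `S` to `S'`: its structure isomorphism is the
restriction of that of `P`. -/
noncomputable def restrict {A' B' : Type*} [Category* A'] [Category* B'] {S' : Monad A'} {T' : Monad B'}
    {y : A ⥤ B} {y' : A' ⥤ B'} [y'.Full] [y'.Faithful] (φ : MonadMap S T y)
    (φ' : MonadMap S' T' y') {P : B ⥤ B'} (π : MonadMap T T' P) {C : A ⥤ A'}
    (ρ : y ⋙ P ≅ C ⋙ y') : MonadMap S S' C where
  iso X := y'.preimageIso ((φ'.iso (C.obj X)).symm ≪≫ T'.mapIso (ρ.symm.app X) ≪≫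
    π.iso (y.obj X) ≪≫ P.mapIso (φ.iso X) ≪≫ ρ.app (S.obj X))
  naturality {X Y} f := by
    apply y'.map_injective
    have h₁ := φ'.naturality (C.map f)
    have h₂ := ρ.inv.naturality f
    have h₃ := π.naturality (y.map f)
    have h₄ := φ.naturality f
    have h₅ := ρ.hom.naturality (S.map f)
    dsimp at h₁ h₂ h₃ h₄ h₅
    simp only [Functor.map_comp, Functor.preimageIso_hom, Functor.map_preimage, Iso.trans_hom,
      Iso.symm_hom, Functor.mapIso_hom, Iso.app_hom, Category.assoc]
    rw [← cancel_epi (φ'.iso (C.obj X)).hom, ← Category.assoc, ← h₁]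
    simp only [Category.assoc, Iso.hom_inv_id_assoc]
    dsimp
    rw [← h₅, ← T'.map_comp_assoc, h₂, T'.map_comp_assoc, ← P.map_comp_assoc, ← h₄,
      P.map_comp_assoc, reassoc_of% h₃]
  unit X := by
    apply y'.map_injective
    have h₁ := φ'.unit (C.obj X)
    have h₂ := T'.η.naturality (ρ.inv.app X)
    have h₃ := π.unit (y.obj X)
    have h₄ := φ.unit X
    have h₅ := ρ.hom.naturality (S.η.app X)
    dsimp at h₁ h₂ h₃ h₄ h₅
    simp only [Functor.map_comp, Functor.preimageIso_hom, Functor.map_preimage, Iso.trans_hom,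
      Iso.symm_hom, Functor.mapIso_hom, Iso.app_hom]
    rw [← h₁]
    simp only [Category.assoc, Iso.hom_inv_id_assoc]
    dsimp
    rw [← reassoc_of% h₂, reassoc_of% h₃, ← P.map_comp_assoc, h₄, h₅]
    simp
  mul X := by
    apply y'.map_injective
    have h₁ := φ'.mul (C.obj X)
    have h₂ := T'.μ.naturality (ρ.inv.app X)
    have h₃ := π.mul (y.obj X)
    have h₄ := φ.mul X
    have h₅ := ρ.hom.naturality (S.μ.app X)
    have h₆ := π.naturality (φ.iso X).hom
    dsimp at h₁ h₂ h₃ h₄ h₅ h₆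
    simp only [Functor.map_comp, Functor.preimageIso_hom, Functor.map_preimage, Iso.trans_hom,
      Iso.symm_hom, Functor.mapIso_hom, Iso.app_hom, Category.assoc]
    set ψ := (φ'.iso (C.obj X)).inv ≫ T'.map (ρ.inv.app X) ≫ (π.iso (y.obj X)).hom ≫
      P.map (φ.iso X).hom ≫ ρ.hom.app (S.obj X) with hψ
    have h₇ := φ'.naturality (y'.preimage ψ)
    rw [y'.map_preimage] at h₇
    have h₈ : T'.map (φ'.iso (C.obj X)).hom ≫ T'.map ψ = T'.map (T'.map (ρ.inv.app X)) ≫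
        T'.map (π.iso (y.obj X)).hom ≫ T'.map (P.map (φ.iso X).hom) ≫
        T'.map (ρ.hom.app (S.obj X)) := by
      simp only [hψ, ← T'.map_comp, Iso.hom_inv_id_assoc]
    have h₉ : T'.map (ρ.hom.app (S.obj X)) ≫ T'.map (ρ.inv.app (S.obj X)) = 𝟙 _ := by
      rw [← T'.map_comp, ρ.hom_inv_id_app, T'.map_id]
    rw [← cancel_epi (φ'.iso (S'.obj (C.obj X))).hom,
      ← cancel_epi (T'.map (φ'.iso (C.obj X)).hom), ← reassoc_of% h₁, ← reassoc_of% h₇,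
      reassoc_of% h₈]
    simp only [Iso.hom_inv_id_assoc]
    have h₁₀ : (φ'.iso (C.obj X)).hom ≫ ψ = T'.map (ρ.inv.app X) ≫ (π.iso (y.obj X)).hom ≫
        P.map (φ.iso X).hom ≫ ρ.hom.app (S.obj X) := by
      rw [hψ, Iso.hom_inv_id_assoc]
    rw [← h₅, reassoc_of% h₉, reassoc_of% h₆, h₁₀, ← reassoc_of% h₂, reassoc_of% h₃,
      ← P.map_comp_assoc, h₄]
    simp only [P.map_comp, Category.assoc]

end MonadMap

/-- The extension of a functor to the idempotent completions, `(x, p) ↦ (F x, F p)`. -/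
@[simps, reducible]
def idempFunctor (F : A ⥤ B) : Karoubi A ⥤ Karoubi B where
  obj P := ⟨F.obj P.X, F.map P.p, by rw [← F.map_comp, P.idem]⟩
  map f := ⟨F.map f.f, by simp only [← F.map_comp, f.comm]⟩

/-- The extension of a monad to the idempotent completion. -/
def idempMonad (M : CategoryTheory.Monad A) : CategoryTheory.Monad (Karoubi A) where
  toFunctor := idempFunctor M.toFunctor
  η :=
    { app := fun P => ⟨P.p ≫ M.η.app P.X, by
        have := M.η.naturality P.p
        dsimp at this ⊢
        simp only [Category.assoc, ← this, P.idem_assoc]⟩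
      naturality := fun P Q f => by
        ext
        have := M.η.naturality f.f
        dsimp at this ⊢
        simp only [Category.assoc, ← this, Karoubi.comp_p_assoc, Karoubi.p_comp_assoc] }
  μ :=
    { app := fun P => ⟨M.map (M.map P.p) ≫ M.μ.app P.X, by
        have := M.μ.naturality P.p
        dsimp at this ⊢
        simp only [Category.assoc, ← this, ← Functor.map_comp_assoc, ← Functor.map_comp, P.idem]⟩
      naturality := fun P Q f => by
        ext
        have := M.μ.naturality f.f
        dsimp at this ⊢
        simp only [Category.assoc, ← this, ← Functor.map_comp_assoc, ← Functor.map_comp,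
          Karoubi.comp_p, Karoubi.p_comp] }
  assoc P := by
    ext
    have h₁ := M.μ.naturality P.p
    have h₂ := M.assoc P.X
    have h₃ := M.μ.naturality (M.map P.p)
    dsimp at h₁ h₂ h₃ ⊢
    simp only [Functor.map_comp, Category.assoc]
    rw [h₁, reassoc_of% h₂]
  left_unit P := by
    ext
    have h₁ := M.left_unit P.X
    have h₂ := M.μ.naturality P.p
    dsimp at h₁ h₂ ⊢
    rw [h₂, Category.assoc, reassoc_of% h₁, ← M.map_comp, P.idem]
  right_unit P := by
    ext
    have h₁ := M.right_unit P.X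
    have h₂ := M.μ.naturality P.p
    dsimp at h₁ h₂ ⊢
    rw [h₂, M.map_comp, Category.assoc, reassoc_of% h₁, ← M.map_comp, P.idem]

/-- The extension of a morphism of monads to the idempotent completions. -/
def MonadMap.idemp {S : CategoryTheory.Monad A} {T : CategoryTheory.Monad B} {K : A ⥤ B}
    (φ : MonadMap S T K) : MonadMap (idempMonad S) (idempMonad T) (idempFunctor K) where
  iso P :=
    { hom := ⟨T.map (K.map P.p) ≫ (φ.iso P.X).hom, by
        have := φ.naturality P.p
        dsimp [idempMonad]
        rw [Category.assoc, ← this]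
        simp only [← Functor.map_comp_assoc, ← Functor.map_comp, P.idem]⟩
      inv := ⟨(φ.iso P.X).inv ≫ T.map (K.map P.p), by
        have := φ.naturality P.p
        dsimp [idempMonad]
        rw [← cancel_epi (φ.iso P.X).hom, ← reassoc_of% this]
        simp only [Category.assoc, Iso.hom_inv_id_assoc, ← Functor.map_comp, P.idem]⟩
      hom_inv_id := by
        ext
        dsimp [idempMonad]
        simp only [Category.assoc, Iso.hom_inv_id_assoc, ← Functor.map_comp, P.idem]
      inv_hom_id := by
        ext
        have := φ.naturality P.p
        dsimp [idempMonad]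
        rw [← cancel_epi (φ.iso P.X).hom, ← this]
        simp only [Category.assoc, Iso.hom_inv_id_assoc, ← Functor.map_comp_assoc,
          ← Functor.map_comp, P.idem] }
  naturality {P Q} f := by
    ext
    have := φ.naturality f.f
    dsimp [idempMonad]
    rw [Category.assoc, ← this]
    simp only [← Functor.map_comp_assoc, ← Functor.map_comp, Karoubi.p_comp, Karoubi.comp_p]
  unit P := by
    ext
    have h₁ := φ.unit P.X
    have h₂ := T.η.naturality (K.map P.p)
    dsimp [idempMonad] at h₁ h₂ ⊢
    rw [Category.assoc, ← reassoc_of% h₂, h₁]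
    simp only [← Functor.map_comp, P.idem_assoc]
  mul P := by
    ext
    have h₁ := φ.mul P.X
    have h₂ := T.μ.naturality (K.map P.p)
    have h₃ := φ.naturality (S.map P.p)
    have h₄ := φ.naturality P.p
    dsimp [idempMonad] at h₁ h₂ h₃ h₄ ⊢
    have h₅ : T.map (φ.iso P.X).hom ≫ T.map (K.map (S.map P.p)) =
        T.map (T.map (K.map P.p)) ≫ T.map (φ.iso P.X).hom := by
      rw [← T.map_comp, ← T.map_comp, h₄]
    have h₆ : T.map (T.map (K.map P.p)) ≫ T.map (T.map (K.map P.p)) =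
        T.map (T.map (K.map P.p)) := by
      simp only [← Functor.map_comp, P.idem]
    simp only [Functor.map_comp, Category.assoc]
    rw [← reassoc_of% h₂, reassoc_of% h₆, h₁, ← reassoc_of% h₃, reassoc_of% h₅, reassoc_of% h₅,
      reassoc_of% h₆, reassoc_of% h₆]

/-- The embedding of a category into its idempotent completion, as a morphism of monads. -/
def MonadMap.toIdemp (M : CategoryTheory.Monad A) :
    MonadMap M (idempMonad M) (toKaroubi A) where
  iso X :=
    { hom := ⟨𝟙 (M.obj X), by simp [idempMonad]⟩
      inv := ⟨𝟙 (M.obj X), by simp [idempMonad]⟩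
      hom_inv_id := by ext; simp [idempMonad]
      inv_hom_id := by ext; simp [idempMonad] }
  naturality f := by ext; simp [idempMonad]
  unit X := by ext; simp [idempMonad]
  mul X := by ext; simp [idempMonad]

end Monads

/-! ### DG modules -/

/-- A right DG module over `A`.  `act h f x` is `x · f`. -/
structure DGModule.{w, u, v, t} {k : Type w} [CommRing k] (A : DGCat.{w, u, v} k) where
  obj : A.Obj → ℤ → Type t
  [addCommGroup : ∀ X n, AddCommGroup (obj X n)]
  [module : ∀ X n, Module k (obj X n)]
  d : ∀ {X : A.Obj} {n m : ℤ}, n + 1 = m → (obj X n →ₗ[k] obj X m)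
  act : ∀ {X Y : A.Obj} {a b c : ℤ}, a + b = c → (A.Hom X Y a →ₗ[k] obj Y b →ₗ[k] obj X c)
  d_d : ∀ {X : A.Obj} {n m l : ℤ} (h : n + 1 = m) (h' : m + 1 = l) (x : obj X n),
    d h' (d h x) = 0
  d_act : ∀ {X Y : A.Obj} {a b c a' b' c' : ℤ} (h : a + b = c) (ha : a + 1 = a')
    (hb : b + 1 = b') (hc : c + 1 = c') (h₁ : a + b' = c') (h₂ : a' + b = c')
    (f : A.Hom X Y a) (x : obj Y b),
    d hc (act h f x) = act h₁ f (d hb x) + b.negOnePow • act h₂ (A.d ha f) x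
  id_act : ∀ {X : A.Obj} {n : ℤ} (h : 0 + n = n) (x : obj X n), act h (A.id X) x = x
  comp_act : ∀ {X Y Z : A.Obj} {a b c ab bc abc : ℤ} (h : a + b = ab) (h' : ab + c = abc)
    (h₁ : b + c = bc) (h₂ : a + bc = abc) (f : A.Hom X Y a) (g : A.Hom Y Z b) (x : obj Z c),
    act h' (A.comp h f g) x = act h₂ f (act h₁ g x)

attribute [instance] DGModule.addCommGroup DGModule.module

namespace DGModule

variable {k : Type*} [CommRing k] {A : DGCat k}

/-- Pairs of integers differing by `n`. -/
structure Deg (n : ℤ) where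
  src : ℤ
  tgt : ℤ
  eq : src + n = tgt

/-- The morphisms `M → N` of degree `n` (not necessarily commuting with the differentials). -/
def homs (M N : DGModule A) (n : ℤ) :
    Submodule k (∀ (X : A.Obj) (p : Deg n), M.obj X p.src →ₗ[k] N.obj X p.tgt) where
  carrier := { φ | ∀ (X Y : A.Obj) (a b c b' c' : ℤ) (h : a + b = c) (hb : b + n = b')
    (hc : c + n = c') (h' : a + b' = c') (f : A.Hom X Y a) (x : M.obj Y b),
    φ X ⟨c, c', hc⟩ (M.act h f x) = N.act h' f (φ Y ⟨b, b', hb⟩ x) }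
  add_mem' hφ hψ X Y a b c b' c' h hb hc h' f x := by
    simp only [Pi.add_apply, LinearMap.add_apply, map_add]
    rw [hφ X Y a b c b' c' h hb hc h' f x, hψ X Y a b c b' c' h hb hc h' f x]
  zero_mem' X Y a b c b' c' h hb hc h' f x := by simp
  smul_mem' r φ hφ X Y a b c b' c' h hb hc h' f x := by
    simp only [Pi.smul_apply, LinearMap.smul_apply, map_smul]
    rw [hφ X Y a b c b' c' h hb hc h' f x]

/-- The type of morphisms `M → N` of degree `n`. -/
def DGHom (M N : DGModule A) (n : ℤ) : Type _ := M.homs N n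

instance (M N : DGModule A) (n : ℤ) : AddCommGroup (M.DGHom N n) :=
  inferInstanceAs (AddCommGroup (M.homs N n))

instance (M N : DGModule A) (n : ℤ) : Module k (M.DGHom N n) :=
  inferInstanceAs (Module k (M.homs N n))

variable {M N P : DGModule A}

/-- The component of a morphism of degree `n` between given degrees. -/
def DGHom.app {n : ℤ} (φ : M.DGHom N n) (X : A.Obj) {a b : ℤ} (h : a + n = b) :
    M.obj X a →ₗ[k] N.obj X b := φ.1 X ⟨a, b, h⟩

lemma DGHom.app_act {n : ℤ} (φ : M.DGHom N n) {X Y : A.Obj} {a b c b' c' : ℤ} (h : a + b = c)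
    (hb : b + n = b') (hc : c + n = c') (h' : a + b' = c') (f : A.Hom X Y a) (x : M.obj Y b) :
    φ.app X hc (M.act h f x) = N.act h' f (φ.app Y hb x) :=
  φ.2 X Y a b c b' c' h hb hc h' f x

lemma DGHom.ext {n : ℤ} {φ ψ : M.DGHom N n}
    (h : ∀ (X : A.Obj) (a b : ℤ) (h : a + n = b) (x : M.obj X a), φ.app X h x = ψ.app X h x) :
    φ = ψ := by
  apply Subtype.ext
  funext X p
  ext x
  exact h X p.src p.tgt p.eq x

/-- Construct a morphism of degree `n` from its components. -/
def DGHom.mk {n : ℤ} (f : ∀ (X : A.Obj) (a b : ℤ), a + n = b → (M.obj X a →ₗ[k] N.obj X b))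
    (hf : ∀ (X Y : A.Obj) (a b c b' c' : ℤ) (h : a + b = c) (hb : b + n = b')
      (hc : c + n = c') (h' : a + b' = c') (g : A.Hom X Y a) (x : M.obj Y b),
      f X c c' hc (M.act h g x) = N.act h' g (f Y b b' hb x)) : M.DGHom N n :=
  ⟨fun X p => f X p.src p.tgt p.eq, hf⟩

@[simp] lemma DGHom.mk_app {n : ℤ}
    (f : ∀ (X : A.Obj) (a b : ℤ), a + n = b → (M.obj X a →ₗ[k] N.obj X b))
    (hf) (X : A.Obj) {a b : ℤ} (h : a + n = b) :
    (DGHom.mk (M := M) (N := N) f hf).app X h = f X a b h := rfl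

@[simp] lemma DGHom.add_app {n : ℤ} (φ ψ : M.DGHom N n) (X : A.Obj) {a b : ℤ} (h : a + n = b) :
    (φ + ψ).app X h = φ.app X h + ψ.app X h := rfl

@[simp] lemma DGHom.sub_app {n : ℤ} (φ ψ : M.DGHom N n) (X : A.Obj) {a b : ℤ} (h : a + n = b) :
    (φ - ψ).app X h = φ.app X h - ψ.app X h := rfl

@[simp] lemma DGHom.zero_app {n : ℤ} (X : A.Obj) {a b : ℤ} (h : a + n = b) :
    (0 : M.DGHom N n).app X h = 0 := rfl

@[simp] lemma DGHom.smul_app {n : ℤ} (r : k) (φ : M.DGHom N n) (X : A.Obj) {a b : ℤ}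
    (h : a + n = b) : (r • φ).app X h = r • φ.app X h := rfl

@[simp] lemma DGHom.zsmul_app {n : ℤ} (r : ℤ) (φ : M.DGHom N n) (X : A.Obj) {a b : ℤ}
    (h : a + n = b) : (r • φ).app X h = r • φ.app X h := rfl

@[simp] lemma DGHom.units_smul_app {n : ℤ} (r : ℤˣ) (φ : M.DGHom N n) (X : A.Obj) {a b : ℤ}
    (h : a + n = b) : (r • φ).app X h = r • φ.app X h := rfl

/-- The differential of the complex of morphisms, `φ ↦ d φ - (-1)^|φ| φ d`. -/
def homD (M N : DGModule A) {n m : ℤ} (h : n + 1 = m) : M.DGHom N n →ₗ[k] M.DGHom N m where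
  toFun φ := DGHom.mk (fun X a b hab =>
    N.d (by omega : a + n + 1 = b) ∘ₗ φ.app X rfl -
      n.negOnePow • (φ.app X (by omega : a + 1 + n = b) ∘ₗ M.d rfl)) (by
    intro X Y a b c b' c' h' hb hc h'' f x
    simp only [LinearMap.sub_apply, LinearMap.comp_apply, LinearMap.smul_apply, map_sub]
    rw [φ.app_act h' rfl rfl (by omega), M.d_act h' rfl rfl rfl (by omega) (by omega), map_add,
      φ.app_act (by omega : a + (b + 1) = c + 1) (by omega : b + 1 + n = b') (by omega) h'',
      map_zsmul_unit,
      φ.app_act (by omega : a + 1 + b = c + 1) rfl (by omega) (by omega : a + 1 + (b + n) = c'),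
      N.d_act _ rfl (by omega : b + n + 1 = b') _ h'' (by omega), Int.negOnePow_add,
      map_zsmul_unit, smul_add, smul_smul, mul_comm n.negOnePow b.negOnePow]
    abel)
  map_add' φ ψ := DGHom.ext fun X a b hab x => by
    simp
    abel
  map_smul' r φ := DGHom.ext fun X a b hab x => by
    simp [smul_sub, smul_comm r]

lemma homD_app {n m : ℤ} (h : n + 1 = m) (φ : M.DGHom N n) (X : A.Obj) {a b c e : ℤ}
    (hab : a + m = b) (hc : a + n = c) (hc' : c + 1 = b) (he : a + 1 = e) (he' : e + n = b)
    (x : M.obj X a) :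
    (homD M N h φ).app X hab x =
      N.d hc' (φ.app X hc x) - n.negOnePow • φ.app X he' (M.d he x) := by
  subst hc he
  rfl

/-- Composition of morphisms: first `φ`, then `ψ`. -/
def homComp {a b c : ℤ} (h : a + b = c) :
    M.DGHom N a →ₗ[k] N.DGHom P b →ₗ[k] M.DGHom P c := LinearMap.mk₂ k
  (fun φ ψ => DGHom.mk (fun X p q hpq => ψ.app X (by omega : p + a + b = q) ∘ₗ φ.app X rfl) (by
    intro X Y a' b' c' b'' c'' h' hb hc h'' f x
    simp only [LinearMap.comp_apply]
    rw [φ.app_act h' rfl rfl (by omega), ψ.app_act _ (by omega : b' + a + b = b'') _ h'']))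
  (fun _ _ _ => DGHom.ext fun _ _ _ _ _ => by simp)
  (fun _ _ _ => DGHom.ext fun _ _ _ _ _ => by simp)
  (fun _ _ _ => DGHom.ext fun _ _ _ _ _ => by simp)
  (fun _ _ _ => DGHom.ext fun _ _ _ _ _ => by simp)

lemma homComp_app {a b c : ℤ} (h : a + b = c) (φ : M.DGHom N a) (ψ : N.DGHom P b) (X : A.Obj)
    {p q r : ℤ} (hpr : p + c = r) (hpq : p + a = q) (hqr : q + b = r) (x : M.obj X p) :
    (homComp h φ ψ).app X hpr x = ψ.app X hqr (φ.app X hpq x) := by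
  subst hpq
  rfl

/-- The identity morphism. -/
def homId (M : DGModule A) : M.DGHom M 0 :=
  DGHom.mk (fun X a b h => (show a = b by omega) ▸ LinearMap.id) (by
    intro X Y a b c b' c' h hb hc h' f x
    obtain rfl : b = b' := by omega
    obtain rfl : c = c' := by omega
    rfl)

lemma homId_app (X : A.Obj) {a : ℤ} (h : a + 0 = a) (x : M.obj X a) :
    M.homId.app X h x = x := rfl

end DGModule

/-- The DG category of right DG modules over `A`, with values in the universe `t`. -/
abbrev DGCat.Mod.{w, u, v, t} {k : Type w} [CommRing k] (A : DGCat.{w, u, v} k) :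
    DGCat.{w, max w u v (t + 1), max u t} k where
  Obj := DGModule.{w, u, v, t} A
  Hom M N n := M.DGHom N n
  d {M N _ _} h := M.homD N h
  comp h := DGModule.homComp h
  id M := M.homId
  d_d {M N n m l} h h' φ := DGModule.DGHom.ext fun X a b hab x => by
    rw [DGModule.homD_app h' _ X hab rfl (by omega) rfl (by omega),
      DGModule.homD_app h φ X rfl rfl (by omega) rfl (by omega),
      DGModule.homD_app h φ X _ (by omega : a + 1 + n = a + m) (by omega) rfl (by omega)]
    subst h
    simp only [map_sub, N.d_d, M.d_d, map_zero, smul_zero, sub_zero, zero_sub, map_zsmul_unit,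
      DGModule.DGHom.zero_app, LinearMap.zero_apply, Int.negOnePow_succ, Units.neg_smul]
    abel
  d_comp {M N P a b c a' b' c'} h ha hb hc h₁ h₂ φ ψ := DGModule.DGHom.ext fun X p q hpq x => by
    rw [DGModule.DGHom.add_app, DGModule.DGHom.units_smul_app, LinearMap.add_apply,
      LinearMap.smul_apply,
      DGModule.homD_app hc _ X hpq rfl (by omega) rfl (by omega),
      DGModule.homComp_app h φ ψ X rfl rfl (by omega),
      DGModule.homComp_app h φ ψ X _ (by omega : p + 1 + a = p + a + 1) (by omega),
      DGModule.homComp_app h₁ φ _ X _ rfl (by omega),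
      DGModule.homComp_app h₂ _ ψ X _ (by omega : p + a' = p + a + 1) (by omega),
      DGModule.homD_app hb _ X _ (by omega : p + a + b = p + c) (by omega) rfl (by omega),
      DGModule.homD_app ha _ X _ rfl (by omega) rfl (by omega)]
    subst h
    simp only [map_sub, map_zsmul_unit, smul_sub, smul_smul, Int.negOnePow_add,
      mul_comm a.negOnePow b.negOnePow]
    abel
  id_comp {M N n} h φ := DGModule.DGHom.ext fun X a b hab x => by
    rw [DGModule.homComp_app h _ _ X _ (add_zero a) hab, DGModule.homId_app]
  comp_id {M N n} h φ := DGModule.DGHom.ext fun X a b hab x => by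
    rw [DGModule.homComp_app h _ _ X _ hab (add_zero b), DGModule.homId_app]
  assoc {M N P Q a b c ab bc abc} h h' h₁ h₂ φ ψ χ := DGModule.DGHom.ext fun X p q hpq x => by
    rw [DGModule.homComp_app h' _ _ X _ rfl (by omega),
      DGModule.homComp_app h _ _ X _ rfl (by omega),
      DGModule.homComp_app h₂ _ _ X _ rfl (by omega),
      DGModule.homComp_app h₁ _ _ X _ (by omega : p + a + b = p + ab) (by omega)]

namespace DGCat

variable {k : Type*} [CommRing k] (A : DGCat k)

/-- The representable DG module `h_Y = Hom(-, Y)`. -/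
def rep (Y : A.Obj) : DGModule A where
  obj X n := A.Hom X Y n
  d h := A.d h
  act h := A.comp h
  d_d := A.d_d
  d_act := A.d_comp
  id_act := A.id_comp
  comp_act := A.assoc

lemma comp_d {X Y Z : A.Obj} {a b c n m e : ℤ} (h : n + 1 = m) (hab : a + m = b)
    (hc : a + n = c) (hcb : c + 1 = b) (he : a + 1 = e) (heb : e + n = b) (x : A.Hom X Y a)
    (f : A.Hom Y Z n) : A.comp hab x (A.d h f) =
      A.d hcb (A.comp hc x f) - n.negOnePow • A.comp heb (A.d he x) f := by
  rw [A.d_comp hc he h hcb hab heb, add_sub_cancel_right]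

/-- The morphism of representable modules `h_Y → h_Z`, `x ↦ f ∘ x`. -/
def repMap {Y Z : A.Obj} {n : ℤ} (f : A.Hom Y Z n) : (A.rep Y).DGHom (A.rep Z) n :=
  DGModule.DGHom.mk (M := A.rep Y) (N := A.rep Z) (fun _ _ _ h => (A.comp h).flip f)
    (fun _ _ _ _ _ _ _ h hb hc h' g x => A.assoc h hc hb h' g x f)

/-- The DG functor `A → Mod(A)`, `Y ↦ h_Y`. -/
def yonedaMod : DGFunctor A A.Mod where
  obj := A.rep
  map {Y Z n} :=
    { toFun := fun f => A.repMap f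
      map_add' := fun f g => DGModule.DGHom.ext fun X a b h x => map_add (A.comp h x) f g
      map_smul' := fun r f => DGModule.DGHom.ext fun X a b h x => map_smul (A.comp h x) r f }
  map_d {Y Z n m} h f := DGModule.DGHom.ext fun X a b hab x => by
    exact (A.comp_d h hab rfl (by omega) rfl (by omega) x f).trans
      (DGModule.homD_app h (A.repMap f) X hab rfl (by omega) rfl (by omega)
        x).symm
  map_id Y := DGModule.DGHom.ext fun X a b h x => by
    obtain rfl : a = b := by omega
    exact A.comp_id h x
  map_comp {X Y Z a b c} h f g := DGModule.DGHom.ext fun W p q hpq x => by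
    refine Eq.trans ?_ (DGModule.homComp_app h (A.repMap f) (A.repMap g) W hpq rfl (by omega) x).symm
    exact (A.assoc rfl (by omega) h hpq x f g).symm

end DGCat

namespace DGModule

variable {k : Type*} [CommRing k] {A : DGCat k}

/-- The zero DG module. -/
def zero (A : DGCat k) : DGModule A where
  obj _ _ := PUnit
  d _ := 0
  act _ := 0
  d_d _ _ _ := rfl
  d_act _ _ _ _ _ _ _ _ := rfl
  id_act _ _ := rfl
  comp_act _ _ _ _ _ _ _ := rfl

/-- The shift `N[m]`: in degree `n` it is `N` in degree `n + m`, with differential `(-1)^m d`. -/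
def shift (N : DGModule A) (m : ℤ) : DGModule A where
  obj X n := N.obj X (n + m)
  d h := m.negOnePow • N.d (by omega)
  act h := N.act (by omega)
  d_d h h' x := by simp [N.d_d]
  d_act {X Y a b c a' b' c'} h ha hb hc h₁ h₂ f x := by
    rw [LinearMap.smul_apply, LinearMap.smul_apply, map_zsmul_unit,
      N.d_act (by omega : a + (b + m) = c + m) ha (by omega : b + m + 1 = b' + m) (by omega)
        (by omega) (by omega : a' + (b + m) = c' + m), smul_add, smul_smul, Int.negOnePow_add,
      mul_comm b.negOnePow, ← mul_assoc, Int.units_mul_self, one_mul]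
  id_act h x := N.id_act _ x
  comp_act h h' h₁ h₂ f g x := N.comp_act h _ _ _ f g x

lemma d_app_of_closed {M N : DGModule A} (φ : A.Mod.Z0Hom M N) (X : A.Obj) {n m n' m' : ℤ}
    (h : n + 1 = m) (e : n + 0 = n') (e' : m + 0 = m') (h' : n' + 1 = m') (x : M.obj X n) :
    N.d h' (DGHom.app φ.val X e x) = DGHom.app φ.val X e' (M.d h x) := by
  have h₀ := congrArg (fun ψ : DGHom M N (0 + 1) => ψ.app X (by omega : n + (0 + 1) = m') x)
    φ.closed
  have h₁ := homD_app rfl φ.val X (by omega : n + (0 + 1) = m') e h' h e' x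
  have h₂ := h₁.symm.trans h₀
  rw [DGHom.zero_app, LinearMap.zero_apply, Int.negOnePow_zero, one_smul] at h₂
  exact sub_eq_zero.mp h₂

/-- The cone of a closed morphism `φ : M ⟶ N` of degree `0`: in degree `n` it is `M` in degree
`n + 1` plus `N` in degree `n`, with differential `(x, y) ↦ (- d x, φ x + d y)`. -/
def cone {M N : DGModule A} (φ : A.Mod.Z0Hom M N) : DGModule A where
  obj X n := M.obj X (n + 1) × N.obj X n
  d {X n m} h := LinearMap.prod (-(M.d (by omega) ∘ₗ LinearMap.fst k _ _))
    (DGHom.app φ.val X (by omega) ∘ₗ LinearMap.fst k _ _ + N.d h ∘ₗ LinearMap.snd k _ _)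
  act {X Y a b c} h := LinearMap.mk₂ k
    (fun f z => (M.act (by omega) f z.1, N.act h f z.2))
    (by intros; simp) (by intros; simp) (by intros; simp) (by intros; simp)
  d_d {X n m l} h h' z := by
    refine Prod.ext ?_ ?_
    · change -(M.d _ (-(M.d _ z.1))) = 0
      rw [map_neg, M.d_d, neg_zero, neg_zero]
    · change DGHom.app φ.val X _ (-(M.d _ z.1)) + N.d h' (DGHom.app φ.val X _ z.1 + N.d h z.2) = 0
      have h₀ := d_app_of_closed φ X (by omega : n + 1 + 1 = m + 1) (by omega : n + 1 + 0 = m)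
        (by omega : m + 1 + 0 = l) h' z.1
      rw [map_neg, map_add, N.d_d, h₀]
      abel
  d_act {X Y a b c a' b' c'} h ha hb hc h₁ h₂ f z := by
    refine Prod.ext ?_ ?_
    · change -(M.d _ (M.act _ f z.1)) = M.act _ f (-(M.d _ z.1)) +
        b.negOnePow • M.act (by omega : a' + (b + 1) = c' + 1) (A.d ha f) z.1
      rw [M.d_act (by omega : a + (b + 1) = c + 1) ha (by omega : b + 1 + 1 = b' + 1)
        (by omega) (by omega) (by omega : a' + (b + 1) = c' + 1), Int.negOnePow_succ, map_neg,
        Units.neg_smul, neg_add, neg_neg]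
    · change DGHom.app φ.val X _ (M.act _ f z.1) + N.d hc (N.act h f z.2) =
        N.act h₁ f (DGHom.app φ.val Y _ z.1 + N.d hb z.2) + b.negOnePow • N.act h₂ (A.d ha f) z.2
      rw [N.d_act h ha hb hc h₁ h₂, DGHom.app_act φ.val _ _ _ h₁, map_add, add_assoc]
  id_act h z := Prod.ext (M.id_act _ z.1) (N.id_act _ z.2)
  comp_act h h' h₁ h₂ f g z := Prod.ext (M.comp_act h _ _ _ f g z.1) (N.comp_act h _ _ _ f g z.2)

end DGModule

/-! ### Perfect DG modules and pretriangulated DG categories -/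

/-- Finitely generated semi-free DG modules: those obtained from `0` by finitely many successive
attachments of shifted representable modules, up to isomorphism.  They are the modules
represented by (one-sided) twisted complexes over `A`. -/
inductive FGSemifree.{w, u, v} {k : Type w} [CommRing k] (A : DGCat.{w, u, v} k) :
    DGModule.{w, u, v, v} A → Prop
  | zero : FGSemifree A (DGModule.zero A)
  | rep (Y : A.Obj) : FGSemifree A (A.rep Y)
  | cone {Y : A.Obj} {n : ℤ} {N : DGModule A} (φ : A.Mod.Z0Hom ((A.rep Y).shift n) N) :
      FGSemifree A N → FGSemifree A (DGModule.cone φ)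
  | iso {N N' : DGModule A} (e : (⟨N⟩ : A.Mod.Z0) ≅ ⟨N'⟩) : FGSemifree A N → FGSemifree A N'

namespace DGCat

universe w u v

variable {k : Type w} [CommRing k]

/-- A DG category is pretriangulated if every twisted complex over it is homotopy equivalent to an
object. -/
class Pretri (A : DGCat.{w, u, v} k) : Prop where
  out : ∀ N : DGModule.{w, u, v, v} A, FGSemifree A N →
    ∃ X : A.Obj, Nonempty (A.Mod.h0 (A.rep X) ≅ A.Mod.h0 N)

/-- A DG module is perfect if it is, up to homotopy, a direct summand of a finitely generated
semi-free DG module. -/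
def IsPerfect (A : DGCat.{w, u, v} k) (N : DGModule.{w, u, v, v} A) : Prop :=
  ∃ N' : DGModule.{w, u, v, v} A, FGSemifree A N' ∧
    Nonempty (Retract (A.Mod.h0 N) (A.Mod.h0 N'))

/-- The DG category `Perf(A)` of perfect DG modules. -/
abbrev Perf (A : DGCat.{w, u, v} k) : DGCat k := A.Mod.full A.IsPerfect

/-- The Yoneda embedding `A → Perf(A)`. -/
def yoneda (A : DGCat.{w, u, v} k) : DGFunctor A A.Perf :=
  A.yonedaMod.fullLift fun Y => ⟨A.rep Y, FGSemifree.rep Y, ⟨Retract.refl _⟩⟩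

end DGCat

namespace DGFunctor

variable {k : Type*} [CommRing k] {A B D : DGCat k}

lemma mapH0_map (F : DGFunctor A B) {X Y : A.Z0} (f : X ⟶ Y) :
    F.mapH0.map (A.toH0.map f) = B.toH0.map (F.mapZ0.map f) := rfl

lemma toH0_map_eq {X Y : A.Z0} {f g : X ⟶ Y} :
    A.toH0.map f = A.toH0.map g ↔ A.IsBoundary (f.val - g.val) :=
  CategoryTheory.Quotient.functor_map_eq_iff A.homotopic f g

lemma mapH0_full (F : DGFunctor A B)
    (h : ∀ {X Y : A.Obj} (g : B.Z0Hom (F.obj X) (F.obj Y)),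
      ∃ f : A.Z0Hom X Y, B.IsBoundary (F.map f.val - g.val)) : F.mapH0.Full where
  map_surjective {X Y} g := by
    obtain ⟨g, rfl⟩ := B.toH0.map_surjective (X := F.mapZ0.obj X.as) (Y := F.mapZ0.obj Y.as) g
    obtain ⟨f, hf⟩ := h g
    exact ⟨A.toH0.map (X := X.as) (Y := Y.as) f, toH0_map_eq.mpr hf⟩

lemma mapH0_faithful (F : DGFunctor A B)
    (h : ∀ {X Y : A.Obj} (f : A.Z0Hom X Y), B.IsBoundary (F.map f.val) → A.IsBoundary f.val) :
    F.mapH0.Faithful where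
  map_injective {X Y} f g hfg := by
    obtain ⟨f, rfl⟩ := A.toH0.map_surjective (X := X.as) (Y := Y.as) f
    obtain ⟨g, rfl⟩ := A.toH0.map_surjective (X := X.as) (Y := Y.as) g
    have h₁ := toH0_map_eq.mp hfg
    refine toH0_map_eq.mpr (h ⟨f.val - g.val, ?_⟩ ?_)
    · rw [DGCat.IsClosed, map_sub, f.closed.d_eq, g.closed.d_eq, sub_zero]
    · rw [map_sub]
      exact h₁

instance fullIncl_full (p : A.Obj → Prop) : (fullIncl A p).mapH0.Full :=
  mapH0_full _ fun g => ⟨⟨g.val, g.closed⟩, -1, rfl, 0, by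
    rw [map_zero]
    exact (sub_self g.val).symm⟩

instance fullIncl_faithful (p : A.Obj → Prop) : (fullIncl A p).mapH0.Faithful :=
  mapH0_faithful _ fun _ h => h

end DGFunctor

open Idempotents in
instance {A B : Type*} [Category* A] [Category* B] (F : A ⥤ B) [F.Faithful] :
    (idempFunctor F).Faithful where
  map_injective h := by
    ext
    exact F.map_injective (congrArg Karoubi.Hom.f h)

open Idempotents in
instance {A B : Type*} [Category* A] [Category* B] (F : A ⥤ B) [F.Full] [F.Faithful] :
    (idempFunctor F).Full where
  map_surjective {P Q} g := by
    obtain ⟨f, hf⟩ := F.map_surjective g.f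
    exact ⟨⟨f, F.map_injective (by simpa [hf] using g.comm)⟩, by ext; exact hf⟩

namespace DGCat

universe w u v

variable {k : Type w} [CommRing k] (A : DGCat.{w, u, v} k)

instance : A.yoneda.mapH0.Full := by
  refine DGFunctor.mapH0_full _ fun {X Y} g => ?_
  let φ : A.Mod.Z0Hom (A.rep X) (A.rep Y) := ⟨g.val, g.closed⟩
  refine ⟨⟨DGModule.DGHom.app φ.val X (add_zero 0) (A.id X), ?_⟩, -1, rfl, 0, ?_⟩
  · refine (DGModule.d_app_of_closed φ X rfl (add_zero 0) (add_zero (0 + 1)) rfl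
      (A.id X)).trans ?_
    refine (congrArg _ (A.d_id X rfl)).trans (map_zero _)
  · have h : A.repMap (DGModule.DGHom.app φ.val X (add_zero 0) (A.id X)) = φ.val := by
      refine DGModule.DGHom.ext fun W a b h x => ?_
      obtain rfl : a = b := by omega
      have h₁ := DGModule.DGHom.app_act φ.val h (add_zero 0) h h x (A.id X)
      refine h₁.symm.trans ?_
      exact congrArg _ (A.comp_id h x)
    rw [map_zero]
    exact (sub_eq_zero.mpr h).symm

instance : A.yoneda.mapH0.Faithful := by
  refine DGFunctor.mapH0_faithful _ fun {X Y} f h => ?_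
  obtain ⟨m, h, ψ, hψ⟩ := h
  refine ⟨m, h, DGModule.DGHom.app (M := A.rep X) (N := A.rep Y) ψ X (zero_add m) (A.id X), ?_⟩
  have h₁ := congrArg (fun χ : (A.rep X).DGHom (A.rep Y) 0 =>
    DGModule.DGHom.app χ X (add_zero 0) (A.id X)) hψ
  have h₂ := DGModule.homD_app (M := A.rep X) (N := A.rep Y) h ψ X (add_zero 0) (zero_add m) h
    (zero_add 1) (by omega) (A.id X)
  have h₃ : (A.rep X).d (zero_add 1) (A.id X) = 0 := A.d_id X (zero_add 1)
  rw [h₃, map_zero, smul_zero, sub_zero] at h₂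
  refine h₂.symm.trans (h₁.trans ?_)
  exact A.id_comp (add_zero 0) f.val

open Idempotents in
/-- Every perfect DG module over a pretriangulated DG category is, up to homotopy, a direct
summand of a representable one, so `H⁰(A)` and `H⁰(Perf(A))` have the same idempotent
completion. -/
instance [A.Pretri] : (idempFunctor A.yoneda.mapH0).IsEquivalence where
  essSurj := ⟨fun P => by
    obtain ⟨N', hN', ⟨r⟩⟩ := P.X.as.as.2
    obtain ⟨X, ⟨e⟩⟩ := Pretri.out N' hN'
    let I := (DGFunctor.fullIncl A.Mod A.IsPerfect).mapH0
    have : I.Full := DGFunctor.fullIncl_full _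
    have : I.Faithful := DGFunctor.fullIncl_faithful _
    let i : P.X ⟶ A.yoneda.mapH0.obj (A.h0 X) := I.preimage (r.i ≫ e.inv)
    let s : A.yoneda.mapH0.obj (A.h0 X) ⟶ P.X := I.preimage (e.hom ≫ r.r)
    have his : i ≫ s = 𝟙 _ := I.map_injective (by
      have h : (r.i ≫ e.inv) ≫ e.hom ≫ r.r = 𝟙 _ := by
        rw [Category.assoc, e.inv_hom_id_assoc, r.retract]
      rw [I.map_comp, I.map_preimage, I.map_preimage]
      exact h.trans (I.map_id _).symm)
    let q : A.h0 X ⟶ A.h0 X := A.yoneda.mapH0.preimage (s ≫ P.p ≫ i)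
    have hq : A.yoneda.mapH0.map q = s ≫ P.p ≫ i := A.yoneda.mapH0.map_preimage _
    refine ⟨⟨A.h0 X, q, A.yoneda.mapH0.map_injective ?_⟩, ⟨⟨⟨s ≫ P.p, ?_⟩, ⟨P.p ≫ i, ?_⟩, ?_, ?_⟩⟩⟩
    · rw [Functor.map_comp, hq]
      simp only [Category.assoc, reassoc_of% his, P.idem_assoc]
    · dsimp only [idempFunctor_obj_p]
      rw [hq]
      simp only [Category.assoc, reassoc_of% his, P.idem]
    · dsimp only [idempFunctor_obj_p]
      rw [hq]
      simp only [Category.assoc, reassoc_of% his, P.idem_assoc]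
    · ext
      refine Eq.trans ?_ hq.symm
      change (s ≫ P.p) ≫ P.p ≫ i = _
      simp only [Category.assoc, P.idem_assoc]
    · ext
      change (P.p ≫ i) ≫ s ≫ P.p = P.p
      simp only [Category.assoc, reassoc_of% his, P.idem]⟩

end DGCat

/-! ### DG monads and DG adjunctions -/

section DGMonads

variable {k : Type*} [CommRing k] {A B A' B' : DGCat k}

/-- A DG monad. -/
structure DGMonad (A : DGCat k) where
  T : DGFunctor A A
  η : DGNatTrans (DGFunctor.id A) T
  μ : DGNatTrans (T.comp T) T
  assoc : ∀ X : A.Obj, T.mapZ0.map (μ.app X) ≫ μ.app X = μ.app (T.obj X) ≫ μ.app X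
  left_unit : ∀ X : A.Obj, η.app (T.obj X) ≫ μ.app X = 𝟙 _
  right_unit : ∀ X : A.Obj, T.mapZ0.map (η.app X) ≫ μ.app X = 𝟙 _

/-- The monad `H⁰(T)` on `H⁰(A)`. -/
def DGMonad.h0 (S : DGMonad A) : CategoryTheory.Monad A.H0 where
  toFunctor := S.T.mapH0
  η :=
    { app := fun X => A.toH0.map (S.η.app X.as.as)
      naturality := fun {X Y} f => by
        obtain ⟨f, rfl⟩ := A.toH0.map_surjective (X := X.as) (Y := Y.as) f
        exact congrArg (fun g : X.as ⟶ S.T.mapZ0.obj Y.as => A.toH0.map g)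
          (DGCat.Z0.hom_ext (S.η.naturality f.val)) }
  μ :=
    { app := fun X => A.toH0.map (S.μ.app X.as.as)
      naturality := fun {X Y} f => by
        obtain ⟨f, rfl⟩ := A.toH0.map_surjective (X := X.as) (Y := Y.as) f
        exact congrArg
          (fun g : S.T.mapZ0.obj (S.T.mapZ0.obj X.as) ⟶ S.T.mapZ0.obj Y.as => A.toH0.map g)
          (DGCat.Z0.hom_ext (S.μ.naturality f.val)) }
  assoc X := congrArg (fun g : S.T.mapZ0.obj (S.T.mapZ0.obj (S.T.mapZ0.obj X.as)) ⟶
    S.T.mapZ0.obj X.as => A.toH0.map g) (S.assoc X.as.as)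
  left_unit X := congrArg (fun g : S.T.mapZ0.obj X.as ⟶ S.T.mapZ0.obj X.as => A.toH0.map g)
    (S.left_unit X.as.as)
  right_unit X := congrArg (fun g : S.T.mapZ0.obj X.as ⟶ S.T.mapZ0.obj X.as => A.toH0.map g)
    (S.right_unit X.as.as)

/-- A morphism of DG monads over a DG functor `K`: a DG isomorphism `T K ≅ K S` compatible with
units and multiplications.  For a fully faithful `K`, it says that `T` is a lift of `S` along `K`. -/
structure DGMonadMap (S : DGMonad A) (T : DGMonad B) (K : DGFunctor A B) where
  iso : DGNatIso (K.comp T.T) (S.T.comp K)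
  unit : ∀ X : A.Obj, T.η.app (K.obj X) ≫ (iso.app X).hom = K.mapZ0.map (S.η.app X)
  mul : ∀ X : A.Obj, T.μ.app (K.obj X) ≫ (iso.app X).hom =
    T.T.mapZ0.map (iso.app X).hom ≫ (iso.app (S.T.obj X)).hom ≫ K.mapZ0.map (S.μ.app X)

/-- The morphism of monads induced on `H⁰`. -/
def DGMonadMap.h0 {S : DGMonad A} {T : DGMonad B} {K : DGFunctor A B} (φ : DGMonadMap S T K) :
    MonadMap S.h0 T.h0 K.mapH0 where
  iso X := B.toH0.mapIso (φ.iso.app X.as.as)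
  naturality {X Y} f := by
    obtain ⟨f, rfl⟩ := A.toH0.map_surjective (X := X.as) (Y := Y.as) f
    exact congrArg (fun g : T.T.mapZ0.obj (K.mapZ0.obj X.as) ⟶ K.mapZ0.obj (S.T.mapZ0.obj Y.as) =>
      B.toH0.map g) (DGCat.Z0.hom_ext (φ.iso.naturality f.val))
  unit X := congrArg (fun g : K.mapZ0.obj X.as ⟶ K.mapZ0.obj (S.T.mapZ0.obj X.as) => B.toH0.map g)
    (φ.unit X.as.as)
  mul X := congrArg (fun g : T.T.mapZ0.obj (T.T.mapZ0.obj (K.mapZ0.obj X.as)) ⟶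
    K.mapZ0.obj (S.T.mapZ0.obj X.as) => B.toH0.map g) (φ.mul X.as.as)

/-- An isomorphism of DG monads `T ≅ S`. -/
structure DGMonadIso (T S : DGMonad A) where
  iso : DGNatIso T.T S.T
  unit : ∀ X : A.Obj, T.η.app X ≫ (iso.app X).hom = S.η.app X
  mul : ∀ X : A.Obj, T.μ.app X ≫ (iso.app X).hom =
    T.T.mapZ0.map (iso.app X).hom ≫ (iso.app (S.T.obj X)).hom ≫ S.μ.app X

/-- The isomorphism of monads induced on `H⁰`. -/
def DGMonadIso.h0 {T S : DGMonad A} (φ : DGMonadIso T S) :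
    MonadMap S.h0 T.h0 (𝟭 A.H0) where
  iso X := A.toH0.mapIso (φ.iso.app X.as.as)
  naturality {X Y} f := by
    obtain ⟨f, rfl⟩ := A.toH0.map_surjective (X := X.as) (Y := Y.as) f
    exact congrArg (fun g : T.T.mapZ0.obj X.as ⟶ S.T.mapZ0.obj Y.as =>
      A.toH0.map g) (DGCat.Z0.hom_ext (φ.iso.naturality f.val))
  unit X := congrArg (fun g : X.as ⟶ S.T.mapZ0.obj X.as => A.toH0.map g) (φ.unit X.as.as)
  mul X := congrArg (fun g : T.T.mapZ0.obj (T.T.mapZ0.obj X.as) ⟶ S.T.mapZ0.obj X.as =>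
    A.toH0.map g) (φ.mul X.as.as)

/-- A DG adjunction `F ⊣ G`, given by its unit and counit. -/
structure DGAdjunction (F : DGFunctor A B) (G : DGFunctor B A) where
  unit : DGNatTrans (DGFunctor.id A) (F.comp G)
  counit : DGNatTrans (G.comp F) (DGFunctor.id B)
  left_triangle : ∀ X : A.Obj, F.mapZ0.map (unit.app X) ≫ counit.app (F.obj X) = 𝟙 _
  right_triangle : ∀ Y : B.Obj, unit.app (G.obj Y) ≫ G.mapZ0.map (counit.app Y) = 𝟙 _

/-- The naturality square of a DG natural transformation in `Z⁰`. -/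
lemma DGNatTrans.z0_naturality {F G : DGFunctor A B} (α : DGNatTrans F G) {X Y : A.Z0}
    (f : X ⟶ Y) : F.mapZ0.map f ≫ α.app Y.as = α.app X.as ≫ G.mapZ0.map f :=
  DGCat.Z0.hom_ext (α.naturality f.val)

lemma DGNatIso.z0_naturality {F G : DGFunctor A B} (α : DGNatIso F G) {X Y : A.Z0}
    (f : X ⟶ Y) : F.mapZ0.map f ≫ (α.app Y.as).hom = (α.app X.as).hom ≫ G.mapZ0.map f :=
  DGCat.Z0.hom_ext (α.naturality f.val)

namespace DGAdjunction

variable {F : DGFunctor A B} {G : DGFunctor B A}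

/-- The DG monad `G F` of a DG adjunction `F ⊣ G`. -/
def monad (adj : DGAdjunction F G) : DGMonad A where
  T := F.comp G
  η := adj.unit
  μ :=
    { app := fun X => G.mapZ0.map (adj.counit.app (F.obj X))
      naturality := fun {X Y n} f => by
        exact (G.map_comp _ _ _).symm.trans
          ((congrArg G.map (adj.counit.naturality (F.map f))).trans (G.map_comp _ _ _)) }
  assoc X := (G.mapZ0.map_comp _ _).symm.trans ((congrArg (fun g => G.mapZ0.map g)
    (adj.counit.z0_naturality (adj.counit.app (F.obj X)))).trans (G.mapZ0.map_comp _ _))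
  left_unit X := adj.right_triangle (F.obj X)
  right_unit X := (G.mapZ0.map_comp _ _).symm.trans ((congrArg (fun g => G.mapZ0.map g)
    (adj.left_triangle X)).trans (G.mapZ0.map_id _))

/-- The Eilenberg-Moore comparison functor of `H⁰(F) ⊣ H⁰(G)`, `Y ↦ (G Y, G ε_Y)`. -/
def comparison (adj : DGAdjunction F G) : B.H0 ⥤ adj.monad.h0.Algebra where
  obj Y :=
    { A := G.mapH0.obj Y
      a := A.toH0.map (G.mapZ0.map (adj.counit.app Y.as.as))
      unit := congrArg (fun g : G.mapZ0.obj Y.as ⟶ G.mapZ0.obj Y.as => A.toH0.map g)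
        (adj.right_triangle Y.as.as)
      assoc := by
        have := (G.mapZ0.map_comp _ _).symm.trans ((congrArg (fun g => G.mapZ0.map g)
          (adj.counit.z0_naturality (adj.counit.app Y.as.as))).trans (G.mapZ0.map_comp _ _))
        exact congrArg (fun g : G.mapZ0.obj (F.mapZ0.obj (G.mapZ0.obj (F.mapZ0.obj
          (G.mapZ0.obj Y.as)))) ⟶ G.mapZ0.obj Y.as => A.toH0.map g) this.symm }
  map {X Y} f :=
    { f := G.mapH0.map f
      h := by
        obtain ⟨f, rfl⟩ := B.toH0.map_surjective (X := X.as) (Y := Y.as) f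
        have := (G.mapZ0.map_comp _ _).symm.trans ((congrArg (fun g => G.mapZ0.map g)
          (adj.counit.z0_naturality f)).trans (G.mapZ0.map_comp _ _))
        exact congrArg (fun g : G.mapZ0.obj (F.mapZ0.obj (G.mapZ0.obj X.as)) ⟶
          G.mapZ0.obj Y.as => A.toH0.map g) this }
  map_id X := by ext; exact G.mapH0.map_id X
  map_comp f g := by ext; exact G.mapH0.map_comp f g

end DGAdjunction

/-- A morphism of DG adjunctions from `F ⊣ G` to `F' ⊣ G'`: DG functors `P` and `E` which
commute with the left and the right adjoints up to DG isomorphism, compatibly with the units and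
the counits. -/
structure DGAdjMap {F : DGFunctor A B} {G : DGFunctor B A} {F' : DGFunctor A' B'}
    {G' : DGFunctor B' A'} (adj : DGAdjunction F G) (adj' : DGAdjunction F' G')
    (P : DGFunctor A A') (E : DGFunctor B B') where
  left : DGNatIso (P.comp F') (F.comp E)
  right : DGNatIso (E.comp G') (G.comp P)
  unit : ∀ X : A.Obj, adj'.unit.app (P.obj X) ≫ G'.mapZ0.map (left.app X).hom ≫
    (right.app (F.obj X)).hom = P.mapZ0.map (adj.unit.app X)
  counit : ∀ Y : B.Obj, F'.mapZ0.map (right.app Y).hom ≫ (left.app (G.obj Y)).hom ≫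
    E.mapZ0.map (adj.counit.app Y) = adj'.counit.app (E.obj Y)

lemma square_aux {C : Type*} [Category* C] {X₁ X₂ X₃ Y₁ Y₂ Y₃ : C} {u₁ : X₁ ⟶ Y₁}
    {u₂ : X₂ ⟶ Y₂} {u₃ : X₃ ⟶ Y₃} {a : X₁ ⟶ X₂} {b : X₂ ⟶ X₃} {a' : Y₁ ⟶ Y₂} {b' : Y₂ ⟶ Y₃}
    (h₁ : u₁ ≫ a' = a ≫ u₂) (h₂ : u₂ ≫ b' = b ≫ u₃) : u₁ ≫ a' ≫ b' = (a ≫ b) ≫ u₃ := by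
  rw [reassoc_of% h₁, h₂, Category.assoc]

lemma map_comp₃ {C D : Type*} [Category* C] [Category* D] (F : C ⥤ D) {X Y Z W : C}
    (a : X ⟶ Y) (b : Y ⟶ Z) (c : Z ⟶ W) : F.map a ≫ F.map b ≫ F.map c = F.map (a ≫ b ≫ c) := by
  simp only [Functor.map_comp]

lemma mul_aux {C : Type*} [Category* C] {X₁ X₂ X₃ X₄ X₅ X₆ X₇ X₈ : C} {m' : X₁ ⟶ X₂}
    {l : X₂ ⟶ X₃} {r : X₃ ⟶ X₄} {l' : X₁ ⟶ X₅} {c : X₅ ⟶ X₃} {r' : X₅ ⟶ X₆} {l'' : X₆ ⟶ X₇}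
    {e : X₇ ⟶ X₃} {r'' : X₇ ⟶ X₈} {m : X₈ ⟶ X₄} {t : X₁ ⟶ X₆} (h₁ : m' ≫ l = l' ≫ c)
    (h₂ : r' ≫ l'' ≫ e = c) (h₃ : e ≫ r = r'' ≫ m) (h₄ : t = l' ≫ r') :
    m' ≫ l ≫ r = t ≫ (l'' ≫ r'') ≫ m := by
  subst h₄
  rw [reassoc_of% h₁, ← h₂]
  simp only [Category.assoc, h₃]

/-- The induced morphism of monads on `H⁰`. -/
def DGAdjMap.monadMap {F : DGFunctor A B} {G : DGFunctor B A} {F' : DGFunctor A' B'}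
    {G' : DGFunctor B' A'} {adj : DGAdjunction F G} {adj' : DGAdjunction F' G'}
    {P : DGFunctor A A'} {E : DGFunctor B B'} (φ : DGAdjMap adj adj' P E) :
    MonadMap adj.monad.h0 adj'.monad.h0 P.mapH0 where
  iso X := A'.toH0.mapIso (G'.mapZ0.mapIso (φ.left.app X.as.as) ≪≫ φ.right.app (F.obj X.as.as))
  naturality {X Y} f := by
    obtain ⟨f, rfl⟩ := A.toH0.map_surjective (X := X.as) (Y := Y.as) f
    have h₁ : G'.mapZ0.map (F'.mapZ0.map (P.mapZ0.map f)) ≫ G'.mapZ0.map (φ.left.app Y.as.as).hom =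
        G'.mapZ0.map (φ.left.app X.as.as).hom ≫ G'.mapZ0.map (E.mapZ0.map (F.mapZ0.map f)) :=
      (G'.mapZ0.map_comp _ _).symm.trans
        ((congrArg (fun g => G'.mapZ0.map g) (φ.left.z0_naturality f)).trans
          (G'.mapZ0.map_comp _ _))
    have h₂ : G'.mapZ0.map (E.mapZ0.map (F.mapZ0.map f)) ≫ (φ.right.app (F.obj Y.as.as)).hom =
        (φ.right.app (F.obj X.as.as)).hom ≫ P.mapZ0.map (G.mapZ0.map (F.mapZ0.map f)) :=
      φ.right.z0_naturality (F.mapZ0.map f)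
    exact congrArg (fun g : G'.mapZ0.obj (F'.mapZ0.obj (P.mapZ0.obj X.as)) ⟶
      P.mapZ0.obj (G.mapZ0.obj (F.mapZ0.obj Y.as)) => A'.toH0.map g) (square_aux h₁ h₂)
  unit X := congrArg (fun g : P.mapZ0.obj X.as ⟶ P.mapZ0.obj (G.mapZ0.obj (F.mapZ0.obj X.as)) =>
    A'.toH0.map g) (φ.unit X.as.as)
  mul X := by
    have h₁ : G'.mapZ0.map (adj'.counit.app (F'.obj (P.obj X.as.as))) ≫
          G'.mapZ0.map (φ.left.app X.as.as).hom =
        G'.mapZ0.map (F'.mapZ0.map (G'.mapZ0.map (φ.left.app X.as.as).hom)) ≫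
          G'.mapZ0.map (adj'.counit.app (E.obj (F.obj X.as.as))) :=
      (G'.mapZ0.map_comp _ _).symm.trans ((congrArg (fun g => G'.mapZ0.map g)
        (adj'.counit.z0_naturality (φ.left.app X.as.as).hom).symm).trans
          (G'.mapZ0.map_comp _ _))
    have h₂ : G'.mapZ0.map (F'.mapZ0.map (φ.right.app (F.obj X.as.as)).hom) ≫
          G'.mapZ0.map (φ.left.app (G.obj (F.obj X.as.as))).hom ≫
          G'.mapZ0.map (E.mapZ0.map (adj.counit.app (F.obj X.as.as))) =
        G'.mapZ0.map (adj'.counit.app (E.obj (F.obj X.as.as))) :=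
      (map_comp₃ G'.mapZ0 _ _ _).trans
        (congrArg (fun g => G'.mapZ0.map g) (φ.counit (F.obj X.as.as)))
    have h₃ : G'.mapZ0.map (E.mapZ0.map (adj.counit.app (F.obj X.as.as))) ≫
          (φ.right.app (F.obj X.as.as)).hom =
        (φ.right.app (F.obj (G.obj (F.obj X.as.as)))).hom ≫
          P.mapZ0.map (G.mapZ0.map (adj.counit.app (F.obj X.as.as))) :=
      φ.right.z0_naturality (adj.counit.app (F.obj X.as.as))
    have h₄ : G'.mapZ0.map (F'.mapZ0.map
          (G'.mapZ0.map (φ.left.app X.as.as).hom ≫ (φ.right.app (F.obj X.as.as)).hom)) =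
        G'.mapZ0.map (F'.mapZ0.map (G'.mapZ0.map (φ.left.app X.as.as).hom)) ≫
          G'.mapZ0.map (F'.mapZ0.map (φ.right.app (F.obj X.as.as)).hom) :=
      (congrArg (fun g => G'.mapZ0.map g) (F'.mapZ0.map_comp _ _)).trans (G'.mapZ0.map_comp _ _)
    exact congrArg (fun g : G'.mapZ0.obj (F'.mapZ0.obj (G'.mapZ0.obj (F'.mapZ0.obj
      (P.mapZ0.obj X.as)))) ⟶ P.mapZ0.obj (G.mapZ0.obj (F.mapZ0.obj X.as)) => A'.toH0.map g)
      (mul_aux h₁ h₂ h₃ h₄)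

end DGMonads

/-! ### Enhancements of triangulated categories -/

section Enhancements

open Limits Pretriangulated Idempotents

universe w u v

variable {k : Type w} [CommRing k]

/-- `X --f--> Y --i--> Z --p--> X[1]` (with `p` of degree `1`) is a standard triangle up to
homotopy: there is a homotopy equivalence between `h_Z` and the cone of `h_X → h_Y` which
identifies `i` with the inclusion of `h_Y` and `p` with the projection to `h_X[1]`. -/
def DGCat.IsConeTriangle (A : DGCat.{w, u, v} k) {X Y Z : A.Obj} (f : A.Z0Hom X Y)
    (i : A.Z0Hom Y Z) (p : A.Hom Z X 1) : Prop :=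
  let K : DGModule A := DGModule.cone (A.yonedaMod.mapZ0.map (X := ⟨X⟩) (Y := ⟨Y⟩) f)
  ∃ (a : A.Mod.Z0Hom (A.rep Z) K) (b : A.Mod.Z0Hom K (A.rep Z)),
    A.Mod.toH0.map (X := ⟨A.rep Z⟩) (Y := ⟨K⟩) a ≫ A.Mod.toH0.map b = 𝟙 _ ∧
    A.Mod.toH0.map (X := ⟨K⟩) (Y := ⟨A.rep Z⟩) b ≫ A.Mod.toH0.map a = 𝟙 _ ∧
    (∀ (W : A.Obj) (n : ℤ) (y : A.Hom W Y n),
      DGModule.DGHom.app b.val W (add_zero n) (0, y) = A.comp (add_zero n) y i.val) ∧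
    ∀ (W : A.Obj) (n : ℤ) (x : A.Hom W Z n),
      (DGModule.DGHom.app a.val W (add_zero n) x).1 = A.comp rfl x p

variable {𝒞 : Type*} [Category* 𝒞] [HasZeroObject 𝒞] [HasShift 𝒞 ℤ] [Preadditive 𝒞]
  [∀ n : ℤ, (shiftFunctor 𝒞 n).Additive] [Pretriangulated 𝒞]

/-- The structure of an exact functor on `ε : H⁰(A) ⥤ 𝒞`, for a pretriangulated DG category `A`:
an extension of `ε` to an additive functor from the graded category `H^*(A)` to the graded category
with morphisms `Hom(-, -[n])` (i.e. a commutation of `ε` with the shifts), which sends the standard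
triangles to distinguished triangles. -/
structure ExactStructure (A : DGCat.{w, u, v} k) (ε : A.H0 ⥤ 𝒞) where
  map : ∀ {X Y : A.Obj} {n : ℤ} (f : A.Hom X Y n), A.IsClosed f →
    ShiftedHom (ε.obj (A.h0 X)) (ε.obj (A.h0 Y)) n
  map_add : ∀ {X Y : A.Obj} {n : ℤ} (f g : A.Hom X Y n) (hf : A.IsClosed f) (hg : A.IsClosed g)
    (hfg : A.IsClosed (f + g)), map (f + g) hfg = map f hf + map g hg
  map_boundary : ∀ {X Y : A.Obj} {n : ℤ} (f : A.Hom X Y n) (hf : A.IsClosed f),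
    A.IsBoundary f → map f hf = 0
  map_degree_zero : ∀ {X Y : A.Obj} (f : A.Z0Hom X Y), map f.val f.closed =
    ShiftedHom.mk₀ 0 rfl (ε.map (A.toH0.map (X := ⟨X⟩) (Y := ⟨Y⟩) f))
  map_comp : ∀ {X Y Z : A.Obj} {a b c : ℤ} (h : a + b = c) (h' : b + a = c) (f : A.Hom X Y a)
    (g : A.Hom Y Z b) (hf : A.IsClosed f) (hg : A.IsClosed g),
    map (A.comp h f g) (hf.comp h hg) = (map f hf).comp (map g hg) h'
  distinguished : ∀ {X Y Z : A.Obj} (f : A.Z0Hom X Y) (i : A.Z0Hom Y Z) (p : A.Hom Z X 1)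
    (hp : A.IsClosed p), A.IsConeTriangle f i p →
    Triangle.mk (ε.map (A.toH0.map (X := ⟨X⟩) (Y := ⟨Y⟩) f))
      (ε.map (A.toH0.map (X := ⟨Y⟩) (Y := ⟨Z⟩) i)) (map p hp) ∈ distTriang 𝒞

variable (𝒞) in
/-- An enhancement of a triangulated category `𝒞` by the pretriangulated DG category `A`: an
equivalence of triangulated categories `ε : H⁰(A) ⥤ 𝒞`. -/
structure Enhancement (A : DGCat.{w, u, v} k) where
  ε : A.H0 ⥤ 𝒞
  [isEquivalence : ε.IsEquivalence]
  exact : ExactStructure A ε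

attribute [instance] Enhancement.isEquivalence

universe u' v'

/-- An enhancement `(C, ε)` of `𝒞`, a lift of the monad `M` to a DG monad on `C`, a lift of that DG
monad to `Perf(C)`, and a pretriangulated DG category `E` with a DG adjunction
`F : Perf(C) ⇄ E : G` whose DG monad `G F` is the DG monad on `Perf(C)`. -/
structure PreSetup (k : Type w) [CommRing k] (M : CategoryTheory.Monad 𝒞) where
  C : DGCat.{w, u, v} k
  [pretriC : C.Pretri]
  enh : Enhancement 𝒞 C
  dgM : DGMonad C
  lift : MonadMap dgM.h0 M enh.ε
  perfM : DGMonad C.Perf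
  perfLift : DGMonadMap dgM perfM C.yoneda
  E : DGCat.{w, u', v'} k
  [pretriE : E.Pretri]
  F : DGFunctor C.Perf E
  G : DGFunctor E C.Perf
  adj : DGAdjunction F G
  monadIso : DGMonadIso adj.monad perfM

attribute [instance] PreSetup.pretriC PreSetup.pretriE

namespace PreSetup

variable {M : CategoryTheory.Monad 𝒞} (S : PreSetup.{w, u, v, u', v'} k M)

/-- The Yoneda embedding `H⁰(C) ⥤ H⁰(Perf(C))`, as a morphism of monads from the one induced by the
DG monad on `C` to the one induced by `F ⊣ G`. -/
def yonedaMonadMap : MonadMap S.dgM.h0 S.adj.monad.h0 S.C.yoneda.mapH0 :=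
  S.perfLift.h0.comp S.monadIso.h0

/-- The comparison functor `Φ` from `H⁰(E)` to the category of modules over the extension of `M` to
the idempotent completion of `𝒞`.  It is the Eilenberg-Moore comparison functor to the modules over
the monad `H⁰(G F)` on `H⁰(Perf(C))`, followed by the identification of the idempotent completions
of `H⁰(Perf(C))`, `H⁰(C)` and `𝒞`. -/
noncomputable def Φ : S.E.H0 ⥤ (idempMonad M).Algebra :=
  S.adj.comparison ⋙ (MonadMap.toIdemp S.adj.monad.h0).modMap ⋙
    S.yonedaMonadMap.idemp.modMap.inv ⋙ S.lift.idemp.modMap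

/-- The objects `e` of `E` such that `G e` is homotopy equivalent to the image of an object
of `C`. -/
def IsQ (e : S.E.Obj) : Prop :=
  ∃ c : S.C.Obj, Nonempty (S.C.Perf.h0 (S.G.obj e) ≅ S.C.Perf.h0 (S.C.yoneda.obj c))

/-- The DG category `Q(C, E)`. -/
abbrev Q : DGCat k := S.E.full S.IsQ

/-- `Γ : H⁰(Q(C, E)) ⥤ M-Mod` is the restriction of the comparison functor: composed with the
embedding of `M`-modules into the modules over the extension of `M` to the idempotent completion,
it is isomorphic to `Φ` on `H⁰(Q(C, E))`. -/
def IsRestriction (Γ : S.Q.H0 ⥤ M.Algebra) : Prop :=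
  Nonempty (Γ ⋙ (MonadMap.toIdemp M).modMap ≅ (DGFunctor.fullIncl S.E S.IsQ).mapH0 ⋙ S.Φ)

end PreSetup

/-- The full setup: moreover `E` is, through the comparison functor `Φ`, an enhancement of the
category of modules over the extension of `M` to the idempotent completion of `𝒞`. -/
structure MonadSetup (k : Type w) [CommRing k] (M : CategoryTheory.Monad 𝒞) extends
    PreSetup.{w, u, v, u', v'} k M where
  isEquivalence : toPreSetup.Φ.IsEquivalence

universe u₁ v₁ u₁' v₁'

variable {𝒞' : Type*} [Category* 𝒞'] [HasZeroObject 𝒞'] [HasShift 𝒞' ℤ] [Preadditive 𝒞']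
  [∀ n : ℤ, (shiftFunctor 𝒞' n).Additive] [Pretriangulated 𝒞']

/-- DG functors `C : C₁ → C₂` and `E : E₁ → E₂` inducing a morphism between the adjoint pairs of
two setups; `perfC` is the DG functor induced by `C` on perfect modules. -/
structure SetupMap {M : CategoryTheory.Monad 𝒞} {M' : CategoryTheory.Monad 𝒞'}
    (S : PreSetup.{w, u, v, u', v'} k M) (S' : PreSetup.{w, u₁, v₁, u₁', v₁'} k M') where
  C : DGFunctor S.C S'.C
  E : DGFunctor S.E S'.E
  perfC : DGFunctor S.C.Perf S'.C.Perf
  perfIso : DGNatIso (S.C.yoneda.comp perfC) (C.comp S'.C.yoneda)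
  adjMap : DGAdjMap S.adj S'.adj perfC E

namespace SetupMap

variable {M : CategoryTheory.Monad 𝒞} {M' : CategoryTheory.Monad 𝒞'}
  {S : PreSetup.{w, u, v, u', v'} k M} {S' : PreSetup.{w, u₁, v₁, u₁', v₁'} k M'}
  (φ : SetupMap S S')

/-- The isomorphism on `H⁰` expressing that `perfC` extends `C`. -/
def perfIsoH0 : S.C.yoneda.mapH0 ⋙ φ.perfC.mapH0 ≅ φ.C.mapH0 ⋙ S'.C.yoneda.mapH0 :=
  NatIso.ofComponents (fun X => S'.C.Perf.toH0.mapIso (φ.perfIso.app X.as.as)) fun {X Y} f => by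
    obtain ⟨f, rfl⟩ := S.C.toH0.map_surjective (X := X.as) (Y := Y.as) f
    exact congrArg (fun g : φ.perfC.mapZ0.obj (S.C.yoneda.mapZ0.obj X.as) ⟶
      S'.C.yoneda.mapZ0.obj (φ.C.mapZ0.obj Y.as) => S'.C.Perf.toH0.map g)
      (φ.perfIso.z0_naturality f)

/-- The functor `H⁰(C)` as a morphism of monads, obtained by restricting the morphism of monads
over `H⁰(Perf(C₁)) ⥤ H⁰(Perf(C₂))` given by the morphism of adjoint pairs. -/
noncomputable def monadMap : MonadMap S.dgM.h0 S'.dgM.h0 φ.C.mapH0 :=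
  MonadMap.restrict S.yonedaMonadMap S'.yonedaMonadMap φ.adjMap.monadMap φ.perfIsoH0

/-- The functor `M-Mod ⥤ M'-Mod` induced by `C`. -/
noncomputable def modFunctor : M.Algebra ⥤ M'.Algebra :=
  S.lift.modMap.inv ⋙ φ.monadMap.modMap ⋙ S'.lift.modMap

lemma isQ_obj {e : S.E.Obj} (he : S.IsQ e) : S'.IsQ (φ.E.obj e) := by
  obtain ⟨c, ⟨i⟩⟩ := he
  exact ⟨φ.C.obj c, ⟨S'.C.Perf.toH0.mapIso (φ.adjMap.right.app e) ≪≫ φ.perfC.mapH0.mapIso i ≪≫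
    S'.C.Perf.toH0.mapIso (φ.perfIso.app c)⟩⟩

/-- The DG functor `Q(φ) : Q(C₁, E₁) → Q(C₂, E₂)`, the restriction of `E`. -/
def Q : DGFunctor S.Q S'.Q :=
  ((DGFunctor.fullIncl S.E S.IsQ).comp φ.E).fullLift fun e => φ.isQ_obj e.2

end SetupMap

end Enhancements

universe w u v u' v' u₁ v₁ u₁' v₁' uc vc uc' vc'

/-! An $M^\natural$-module comes from an $M$-module, up to isomorphism, exactly when its underlying
object comes from $\mathcal C$: an action can be transported along an isomorphism of underlying
objects and pulled back along a fully faithful functor (`MonadMap.modMap_essImage`). The object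
underlying $\Phi(e)$ is $Ge$, up to the identification of idempotent completions. Hence $\mathbf
Q(\mathbf C,\mathbf E)$ is exactly the preimage under $\Phi$ of the essential image of
$M\text{-Mod}$ (`PreSetup.isQ_iff`). An equivalence restricts to an equivalence between a full
subcategory closed under isomorphism and its full preimage, which gives the first claim.

For the second claim the identifications inside $\Phi$ must be undone, since they involve inverses
of equivalences that a morphism of setups does not see directly. The clean statement lives over the
monads $H^0(GF)$ and $H^0(G'F')$: the isomorphism $G'E\cong\mathrm{Perf}(C)G$ is one of modules, so
the Eilenberg–Moore comparison functors commute with $H^0(E)$ (`DGAdjMap.comparisonComp`), and $C_*$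
is by construction the restriction of the functor induced by $\mathrm{Perf}(C)$
(`MonadMap.restrictModMapComp`). The passage between this level and $\Phi$ is
`PreSetup.IsRestriction.comp_inv_comp` in one direction and `PreSetup.nonempty_iso_comp_Φ` in the
other. The embeddings on modules are fully faithful, so isomorphisms of functors can be cancelled
along them; this is why arbitrary $\Gamma$ and $\Gamma'$ are allowed.

For the third claim, the condition on Hom complexes is inherited from $E$, and only essential
surjectivity needs work: if $Ee$ lies in $\mathbf Q(\mathbf C',\mathbf E')$, then $e$ must lie in
$\mathbf Q(\mathbf C,\mathbf E)$. This holds because $H^0(\mathrm{Perf}(C))$ is fully faithful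
whenever $C$ is a quasi-equivalence: every perfect module is a homotopy retract of a representable
one, so full faithfulness propagates from $H^0(\mathbf C)$ through the idempotent completion
(`faithful_of_isEquivalence_idempFunctor`, `full_of_isEquivalence_idempFunctor`). -/

section KaroubiModules

/-! ### Modules over monads and idempotent completion -/

open Idempotents

variable {A B D : Type*} [Category* A] [Category* B] [Category* D]

/-- The extension of a functor to the idempotent completions extends it. -/
def toKaroubiCompIdempFunctor (F : A ⥤ B) :
    toKaroubi A ⋙ idempFunctor F ≅ F ⋙ toKaroubi B :=
  NatIso.ofComponents (fun X =>
    { hom := ⟨𝟙 (F.obj X), by simp⟩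
      inv := ⟨𝟙 (F.obj X), by simp⟩
      hom_inv_id := by ext; simp
      inv_hom_id := by ext; simp }) fun f => by ext; simp

namespace MonadMap

variable {S : Monad A} {T : Monad B} {K : A ⥤ B}

/-- A module lies in the essential image of the functor induced by a morphism of monads over a
fully faithful functor as soon as its underlying object lies in the essential image. -/
lemma modMap_essImage (φ : MonadMap S T K) [K.Full] [K.Faithful] {Y : T.Algebra}
    (hY : K.essImage Y.A) : φ.modMap.essImage Y := by
  obtain ⟨X, ⟨e⟩⟩ := hY
  -- The action of `Y` transported along `e` and pulled back by fullness. The module axioms for `a`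
  -- are then checked after applying the faithful `K`.
  let a : S.obj X ⟶ X := K.preimage ((φ.iso X).inv ≫ T.map e.hom ≫ Y.a ≫ e.inv)
  have ha : (φ.iso X).hom ≫ K.map a = T.map e.hom ≫ Y.a ≫ e.inv := by
    simp [a]
  have hTa : T.map (φ.iso X).hom ≫ T.map (K.map a) =
      T.map (T.map e.hom) ≫ T.map Y.a ≫ T.map e.inv := by
    rw [← T.map_comp, ha]; simp
  refine ⟨⟨X, a, K.map_injective ?_, K.map_injective ?_⟩, ⟨Monad.Algebra.isoMk e ?_⟩⟩
  · have h₂ := T.η.naturality e.hom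
    dsimp at h₂
    rw [K.map_comp, ← φ.unit, Category.assoc, ha, ← Category.assoc, ← h₂, Category.assoc,
      ← Category.assoc (T.η.app _), Y.unit]
    simp
  · have h₂ := T.μ.naturality e.hom
    have h₃ := φ.naturality a
    dsimp at h₂
    have h₄ := φ.mul X
    -- Precomposing with these two isomorphisms produces the right-hand side of `φ.mul`, which
    -- trades `S.μ` for `T.μ`, where associativity of `Y` applies.
    rw [← cancel_epi (φ.iso (S.obj X)).hom, ← cancel_epi (T.map (φ.iso X).hom),
      K.map_comp, K.map_comp, ← reassoc_of% h₃, ha, reassoc_of% hTa, ← reassoc_of% h₄, ha,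
      ← reassoc_of% h₂, Y.assoc_assoc, ← T.map_comp_assoc e.inv, e.inv_hom_id, T.map_id,
      Category.id_comp]
  · dsimp [modMap]
    rw [ha]
    simp

/-- The functor induced on modules commutes with the embeddings into the modules over the
extensions to the idempotent completions. -/
def modMapCompToIdemp (φ : MonadMap S T K) :
    φ.modMap ⋙ (toIdemp T).modMap ≅ (toIdemp S).modMap ⋙ φ.idemp.modMap :=
  NatIso.ofComponents
    (fun X => Monad.Algebra.isoMk ((toKaroubiCompIdempFunctor K).symm.app X.A) (by
      ext
      -- The equation read in `B`: all idempotents involved are identities, so both sides reduce to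
      -- the action `(φ.iso X.A).hom ≫ K.map X.a`.
      change T.map (𝟙 (K.obj X.A)) ≫ (T.map (K.map (𝟙 X.A)) ≫ (φ.iso X.A).hom) ≫
        K.map (𝟙 (S.obj X.A) ≫ X.a) =
          (𝟙 (T.obj (K.obj X.A)) ≫ (φ.iso X.A).hom ≫ K.map X.a) ≫ 𝟙 (K.obj X.A)
      simp))
    fun f => by
      ext
      simp [modMap, toKaroubiCompIdempFunctor]

/-- The functor induced on modules by the restriction of a morphism of monads is the restriction of
the functor induced on modules. -/
noncomputable def restrictModMapComp {A' B' : Type*} [Category* A'] [Category* B']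
    {S' : Monad A'} {T' : Monad B'} {y : A ⥤ B} {y' : A' ⥤ B'} [y'.Full] [y'.Faithful]
    (φ : MonadMap S T y) (φ' : MonadMap S' T' y') {P : B ⥤ B'} (π : MonadMap T T' P)
    {C : A ⥤ A'} (ρ : y ⋙ P ≅ C ⋙ y') :
    (φ.restrict φ' π ρ).modMap ⋙ φ'.modMap ≅ φ.modMap ⋙ π.modMap :=
  NatIso.ofComponents
    (fun X => Monad.Algebra.isoMk (ρ.symm.app X.A) (by
      -- After `y'`, the structure isomorphism of `restrict` begins with the inverse of that of
      -- `φ'`, which cancels, and ends with `ρ.hom`. Naturality of `ρ.inv` at the action is all that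
      -- remains.
      have h := ρ.inv.naturality X.a
      dsimp at h
      simp [modMap, restrict, h]))
    fun f => by
      ext
      exact ρ.inv.naturality f.f

end MonadMap

/-! ### Full faithfulness tested on idempotent completions -/

/-- If `K` becomes an equivalence on the idempotent completions and `K ⋙ P` is faithful, then `P` is
faithful. -/
lemma faithful_of_isEquivalence_idempFunctor (K : A ⥤ B) (P : B ⥤ D)
    [(idempFunctor K).IsEquivalence] [(K ⋙ P).Faithful] : P.Faithful := by
  -- `K` may reach objects of `B` only up to retracts, so it cannot be cancelled directly. On
  -- idempotent completions it is invertible, and `idempFunctor` respects composition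
  -- definitionally.
  have : (idempFunctor K ⋙ idempFunctor P).Faithful :=
    inferInstanceAs (idempFunctor (K ⋙ P)).Faithful
  have : (idempFunctor P).Faithful :=
    Functor.Faithful.of_iso (F := (idempFunctor K).inv ⋙ idempFunctor K ⋙ idempFunctor P)
      (Functor.isoWhiskerRight (idempFunctor K).asEquivalence.counitIso (idempFunctor P))
  exact Functor.Faithful.of_comp_iso (toKaroubiCompIdempFunctor P).symm

/-- If `K` becomes an equivalence on the idempotent completions and `K ⋙ P` is fully faithful, then
`P` is full. -/
lemma full_of_isEquivalence_idempFunctor (K : A ⥤ B) (P : B ⥤ D)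
    [(idempFunctor K).IsEquivalence] [(K ⋙ P).Full] [(K ⋙ P).Faithful] : P.Full := by
  have : (idempFunctor K ⋙ idempFunctor P).Full :=
    inferInstanceAs (idempFunctor (K ⋙ P)).Full
  have : (idempFunctor P).Full := Functor.Full.of_iso
      (F := (idempFunctor K).inv ⋙ idempFunctor K ⋙ idempFunctor P)
      (Functor.isoWhiskerRight (idempFunctor K).asEquivalence.counitIso (idempFunctor P))
  -- Fullness descends from `P ⋙ toKaroubi D` to `P` because `toKaroubi D` is faithful.
  exact Functor.Full.of_comp_faithful_iso (toKaroubiCompIdempFunctor P).symm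

end KaroubiModules

/-! ### Comparison functors and morphisms of DG adjunctions -/

namespace DGAdjMap

variable {k : Type*} [CommRing k] {A B A' B' : DGCat k}

/-- The diagram that makes `right` a morphism of modules: `h₁` will be naturality of `right` at the
counit, and `h₂` the image under `G'` of the compatibility with counits. The middle factor `l ≫ r`
is the structure isomorphism of the induced morphism of monads. -/
lemma hexagon_aux {C : Type*} [Category* C] {X₁ X₂ X₃ X₄ Y₁ Y₂ : C} {t : X₁ ⟶ X₂} {l : X₂ ⟶ X₃}
    {r : X₃ ⟶ X₄} {p : X₄ ⟶ Y₂} {e : X₃ ⟶ Y₁} {r' : Y₁ ⟶ Y₂} {c : X₁ ⟶ Y₁}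
    (h₁ : e ≫ r' = r ≫ p) (h₂ : t ≫ l ≫ e = c) : t ≫ (l ≫ r) ≫ p = c ≫ r' := by
  simp only [← h₂, Category.assoc, h₁]

/-- The comparison functors of two DG adjunctions commute with the functors induced by a morphism
of DG adjunctions. -/
def comparisonComp {F : DGFunctor A B} {G : DGFunctor B A} {F' : DGFunctor A' B'}
    {G' : DGFunctor B' A'} {adj : DGAdjunction F G} {adj' : DGAdjunction F' G'}
    {P : DGFunctor A A'} {E : DGFunctor B B'} (φ : DGAdjMap adj adj' P E) :
    E.mapH0 ⋙ adj'.comparison ≅ adj.comparison ⋙ φ.monadMap.modMap :=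
  NatIso.ofComponents
    (fun Y => Monad.Algebra.isoMk (A'.toH0.mapIso (φ.right.app Y.as.as)) (by
      -- Both identities hold strictly in `Z⁰`; passing to homotopy classes is left to the final
      -- `congrArg`.
      have h₁ := φ.right.z0_naturality (adj.counit.app Y.as.as)
      have h₂ : G'.mapZ0.map (F'.mapZ0.map (φ.right.app Y.as.as).hom) ≫
            G'.mapZ0.map (φ.left.app (G.obj Y.as.as)).hom ≫
            G'.mapZ0.map (E.mapZ0.map (adj.counit.app Y.as.as)) =
          G'.mapZ0.map (adj'.counit.app (E.obj Y.as.as)) :=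
        (map_comp₃ G'.mapZ0 _ _ _).trans
          (congrArg (fun g => G'.mapZ0.map g) (φ.counit Y.as.as))
      exact congrArg (fun g : G'.mapZ0.obj (F'.mapZ0.obj (G'.mapZ0.obj (E.mapZ0.obj Y.as))) ⟶
        P.mapZ0.obj (G.mapZ0.obj Y.as) => A'.toH0.map g) (hexagon_aux h₁ h₂)))
    fun {X Y} f => by
      obtain ⟨f, rfl⟩ := B.toH0.map_surjective (X := X.as) (Y := Y.as) f
      ext
      exact congrArg (fun g : G'.mapZ0.obj (E.mapZ0.obj X.as) ⟶ P.mapZ0.obj (G.mapZ0.obj Y.as) =>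
        A'.toH0.map g) (φ.right.z0_naturality f)

end DGAdjMap

section Restriction

open Idempotents

/-! ### Quasi-equivalences on homotopy categories -/

namespace DGFunctor

variable {k : Type*} [CommRing k] {A B : DGCat k}

lemma IsQuasiEquivalence.mapH0_full {F : DGFunctor A B} (hF : F.IsQuasiEquivalence) :
    F.mapH0.Full :=
  F.mapH0_full fun g =>
    let ⟨f, hf, h⟩ := hF.surj g.val g.closed
    ⟨⟨f, hf⟩, h⟩

lemma IsQuasiEquivalence.mapH0_faithful {F : DGFunctor A B} (hF : F.IsQuasiEquivalence) :
    F.mapH0.Faithful :=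
  F.mapH0_faithful fun f h => hF.inj f.val f.closed h

end DGFunctor

variable {k : Type w} [CommRing k]
  {𝒞 : Type uc} [Category.{vc} 𝒞] [Limits.HasZeroObject 𝒞] [HasShift 𝒞 ℤ] [Preadditive 𝒞]
  [∀ n : ℤ, (shiftFunctor 𝒞 n).Additive] [Pretriangulated 𝒞] {M : CategoryTheory.Monad 𝒞}

/-! ### The category `Q` and restrictions of the comparison functor -/

namespace PreSetup

variable (S : PreSetup.{w, u, v, u', v'} k M)

/-- An object of `E` lies in `Q(C, E)` if and only if the module it corresponds to is a module over
the monad itself. -/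
lemma isQ_iff (e : S.E.Obj) :
    S.IsQ e ↔ (MonadMap.toIdemp M).modMap.essImage (S.Φ.obj (S.E.h0 e)) := by
  let K := idempFunctor S.C.yoneda.mapH0
  let W := (MonadMap.toIdemp S.adj.monad.h0).modMap.obj (S.adj.comparison.obj (S.E.h0 e))
  -- `V` is the value of `Φ` at `e` before its last factor `S.lift.idemp.modMap`. It comes from an
  -- inverse equivalence, so its underlying object is accessible only through the counit, which
  -- yields `i`.
  let V := S.yonedaMonadMap.idemp.modMap.inv.obj W
  let i : K.obj V.A ≅ (toKaroubi S.C.Perf.H0).obj (S.C.Perf.h0 (S.G.obj e)) :=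
    (Monad.forget _).mapIso (S.yonedaMonadMap.idemp.modMap.asEquivalence.counitIso.app W)
  constructor
  · rintro ⟨c, ⟨j⟩⟩
    let t : V.A ≅ (toKaroubi S.C.H0).obj (S.C.h0 c) := K.preimageIso (i ≪≫
      (toKaroubi _).mapIso j ≪≫ ((toKaroubiCompIdempFunctor S.C.yoneda.mapH0).app
        (S.C.h0 c)).symm)
    -- Only the underlying object matters: that of `Φ e` is the image of `V.A`, and `t` identifies
    -- `V.A` with an object of `C`.
    refine MonadMap.modMap_essImage _ ⟨S.enh.ε.obj (S.C.h0 c), ⟨?_⟩⟩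
    exact ((toKaroubiCompIdempFunctor S.enh.ε).app _).symm ≪≫ (idempFunctor S.enh.ε).mapIso t.symm
  · rintro ⟨X, ⟨j⟩⟩
    let j' : (toKaroubi 𝒞).obj X.A ≅ (idempFunctor S.enh.ε).obj V.A := (Monad.forget _).mapIso j
    -- The underlying object of the given `M`-module is moved to `H⁰(C)` by the enhancement. Full
    -- faithfulness on idempotent completions identifies it with `V.A`, and applying `K` compares it
    -- with `G e`.
    let c := S.enh.ε.objPreimage X.A
    let t : V.A ≅ (toKaroubi S.C.H0).obj c := (idempFunctor S.enh.ε).preimageIso (j'.symm ≪≫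
      (toKaroubi _).mapIso (S.enh.ε.objObjPreimageIso X.A).symm ≪≫
        ((toKaroubiCompIdempFunctor S.enh.ε).app _).symm)
    exact ⟨c.as.as, ⟨(toKaroubi S.C.Perf.H0).preimageIso (i.symm ≪≫ K.mapIso t ≪≫
      (toKaroubiCompIdempFunctor S.C.yoneda.mapH0).app c)⟩⟩

variable {S}

/-- By `isQ_iff`, `Φ` maps `Q` into the essential image of the fully faithful embedding of
`M`-modules, so it lifts through that embedding. -/
lemma exists_isRestriction : ∃ Γ : S.Q.H0 ⥤ M.Algebra, S.IsRestriction Γ :=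
  ⟨Functor.essImage.liftFunctor ((DGFunctor.fullIncl S.E S.IsQ).mapH0 ⋙ S.Φ)
      (MonadMap.toIdemp M).modMap fun e => (S.isQ_iff e.as.as.1).mp e.as.as.2,
    ⟨Functor.essImage.liftFunctorCompIso _ _ _⟩⟩

/-- Full faithfulness passes from the inclusion of `Q` and `Φ` to `Γ` by cancelling the embedding of
modules. Essential surjectivity uses that `Q` contains every object whose image under `Φ` is an
`M`-module. -/
lemma IsRestriction.isEquivalence [S.Φ.IsEquivalence] {Γ : S.Q.H0 ⥤ M.Algebra}
    (h : S.IsRestriction Γ) : Γ.IsEquivalence := by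
  obtain ⟨α⟩ := h
  have : (DGFunctor.fullIncl S.E S.IsQ).mapH0.Full := DGFunctor.fullIncl_full _
  have : (DGFunctor.fullIncl S.E S.IsQ).mapH0.Faithful := DGFunctor.fullIncl_faithful _
  exact
    { faithful := Functor.Faithful.of_comp_iso α
      full := Functor.Full.of_comp_faithful_iso α
      essSurj := ⟨fun m => by
        let T := (MonadMap.toIdemp M).modMap
        let j := S.Φ.objObjPreimageIso (T.obj m)
        have hq : S.IsQ (S.Φ.objPreimage (T.obj m)).as.as :=
          (S.isQ_iff _).mpr ⟨m, ⟨j.symm⟩⟩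
        exact ⟨S.Q.h0 ⟨_, hq⟩, ⟨T.preimageIso (α.app _ ≪≫ j)⟩⟩⟩ }

/-- The description of a restriction `Γ` of the comparison functor in terms of the DG monad on
`C`. -/
lemma IsRestriction.comp_inv_comp {Γ : S.Q.H0 ⥤ M.Algebra} (h : S.IsRestriction Γ) :
    Nonempty ((Γ ⋙ S.lift.modMap.inv) ⋙ S.yonedaMonadMap.modMap ≅
      (DGFunctor.fullIncl S.E S.IsQ).mapH0 ⋙ S.adj.comparison) := by
  obtain ⟨α⟩ := h
  let L := S.lift.modMap
  let J := (DGFunctor.fullIncl S.E S.IsQ).mapH0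
  let Y := S.yonedaMonadMap.idemp.modMap
  let TP := (MonadMap.toIdemp S.adj.monad.h0).modMap
  let TD := (MonadMap.toIdemp S.dgM.h0).modMap
  -- Writing `Γ` as `Γ ⋙ L.inv ⋙ L` makes both sides of the hypothesis end in the same equivalence
  -- `S.lift.idemp.modMap`, which can then be cancelled.
  let β : ((Γ ⋙ L.inv) ⋙ TD) ⋙ S.lift.idemp.modMap ≅
      (J ⋙ S.adj.comparison ⋙ TP ⋙ Y.inv) ⋙ S.lift.idemp.modMap :=
    Functor.isoWhiskerLeft (Γ ⋙ L.inv) S.lift.modMapCompToIdemp.symm ≪≫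
      Functor.isoWhiskerLeft Γ (Functor.isoWhiskerRight L.asEquivalence.counitIso
        (MonadMap.toIdemp M).modMap) ≪≫ α
  let γ : (Γ ⋙ L.inv) ⋙ TD ≅ J ⋙ S.adj.comparison ⋙ TP ⋙ Y.inv :=
    Functor.fullyFaithfulCancelRight S.lift.idemp.modMap β
  -- Composing with `Y` removes the factor `Y.inv` of `Φ`; what is left on both sides ends in the
  -- fully faithful `TP`.
  let δ : ((Γ ⋙ L.inv) ⋙ S.yonedaMonadMap.modMap) ⋙ TP ≅ (J ⋙ S.adj.comparison) ⋙ TP :=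
    Functor.isoWhiskerLeft (Γ ⋙ L.inv) S.yonedaMonadMap.modMapCompToIdemp ≪≫
      Functor.isoWhiskerRight γ Y ≪≫
      Functor.isoWhiskerLeft (J ⋙ S.adj.comparison ⋙ TP) Y.asEquivalence.counitIso
  exact ⟨Functor.fullyFaithfulCancelRight TP δ⟩

/-- If a functor `N` to the modules over the monad on `H⁰(C)` agrees with the Eilenberg-Moore
comparison functor along `R`, then the corresponding functor to the `M`-modules agrees with `Φ`
along `R`. -/
lemma nonempty_iso_comp_Φ {X : Type*} [Category* X] {N : X ⥤ S.dgM.h0.Algebra} {R : X ⥤ S.E.H0}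
    (α : N ⋙ S.yonedaMonadMap.modMap ≅ R ⋙ S.adj.comparison) :
    Nonempty ((N ⋙ S.lift.modMap) ⋙ (MonadMap.toIdemp M).modMap ≅ R ⋙ S.Φ) := by
  let Y := S.yonedaMonadMap.idemp.modMap
  let TP := (MonadMap.toIdemp S.adj.monad.h0).modMap
  let TD := (MonadMap.toIdemp S.dgM.h0).modMap
  -- Inserting `Y ⋙ Y.inv` brings in the Yoneda functor on modules, to which `α` applies; the
  -- remaining `Y.inv` is the one occurring in `Φ`.
  let β : N ⋙ TD ≅ R ⋙ S.adj.comparison ⋙ TP ⋙ Y.inv :=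
    Functor.isoWhiskerLeft (N ⋙ TD) Y.asEquivalence.unitIso ≪≫
      Functor.isoWhiskerLeft N (Functor.isoWhiskerRight
        S.yonedaMonadMap.modMapCompToIdemp.symm Y.inv) ≪≫
      Functor.isoWhiskerRight α (TP ⋙ Y.inv)
  exact ⟨Functor.isoWhiskerLeft N S.lift.modMapCompToIdemp ≪≫
    Functor.isoWhiskerRight β S.lift.idemp.modMap⟩

end PreSetup

/-! ### Morphisms of setups: compatibility and quasi-equivalences -/

namespace SetupMap

variable {𝒞' : Type uc'} [Category.{vc'} 𝒞'] [Limits.HasZeroObject 𝒞'] [HasShift 𝒞' ℤ]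
  [Preadditive 𝒞'] [∀ n : ℤ, (shiftFunctor 𝒞' n).Additive] [Pretriangulated 𝒞']
  {M' : CategoryTheory.Monad 𝒞'} {S : PreSetup.{w, u, v, u', v'} k M}
  {S' : PreSetup.{w, u₁, v₁, u₁', v₁'} k M'} (φ : SetupMap S S')

/-- The functor `H⁰(Q(φ))` is the restriction of `H⁰(E)`. -/
def QCompFullIncl : φ.Q.mapH0 ⋙ (DGFunctor.fullIncl S'.E S'.IsQ).mapH0 ≅
    (DGFunctor.fullIncl S.E S.IsQ).mapH0 ⋙ φ.E.mapH0 :=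
  NatIso.ofComponents (fun _ => Iso.refl _) fun {X Y} f => by
    obtain ⟨f, rfl⟩ := S.Q.toH0.map_surjective (X := X.as) (Y := Y.as) f
    exact (Category.comp_id _).trans (Category.id_comp _).symm

/-- Both functors become isomorphic after embedding into modules over the extension of `M'` to the
idempotent completion. The comparison is made at the level of modules over `H⁰(G' F')`, where the
morphism of adjunctions acts directly. -/
lemma nonempty_comp_modFunctor_iso {Γ : S.Q.H0 ⥤ M.Algebra} {Γ' : S'.Q.H0 ⥤ M'.Algebra}
    (h : S.IsRestriction Γ) (h' : S'.IsRestriction Γ') :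
    Nonempty (Γ ⋙ φ.modFunctor ≅ φ.Q.mapH0 ⋙ Γ') := by
  obtain ⟨α⟩ := h.comp_inv_comp
  obtain ⟨α'⟩ := h'
  let J := (DGFunctor.fullIncl S.E S.IsQ).mapH0
  let N := Γ ⋙ S.lift.modMap.inv
  -- Three squares are pasted: restriction along the Yoneda embeddings, the description of `Γ`
  -- through the comparison functor, and the compatibility of the comparison functors with `E`.
  let β : (N ⋙ φ.monadMap.modMap) ⋙ S'.yonedaMonadMap.modMap ≅
      (J ⋙ φ.E.mapH0) ⋙ S'.adj.comparison :=
    Functor.isoWhiskerLeft N (MonadMap.restrictModMapComp S.yonedaMonadMap S'.yonedaMonadMap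
      φ.adjMap.monadMap φ.perfIsoH0) ≪≫ Functor.isoWhiskerRight α φ.adjMap.monadMap.modMap ≪≫
      Functor.isoWhiskerLeft J φ.adjMap.comparisonComp.symm
  obtain ⟨γ⟩ := PreSetup.nonempty_iso_comp_Φ β
  let δ : (Γ ⋙ φ.modFunctor) ⋙ (MonadMap.toIdemp M').modMap ≅
      (φ.Q.mapH0 ⋙ Γ') ⋙ (MonadMap.toIdemp M').modMap :=
    γ ≪≫ Functor.isoWhiskerRight φ.QCompFullIncl.symm S'.Φ ≪≫
      Functor.isoWhiskerLeft φ.Q.mapH0 α'.symm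
  exact ⟨Functor.fullyFaithfulCancelRight _ δ⟩

variable {φ}

/-- Up to isomorphism `Perf(C)` sends `G e` to `G' (E e)`, hence to some object of `C'`, which in
turn comes from `C`. Full faithfulness of `H⁰(Perf(C))` reflects the resulting isomorphism. -/
lemma isQ_of_isQ_obj (hC : φ.C.IsQuasiEquivalence) {e : S.E.Obj} (he : S'.IsQ (φ.E.obj e)) :
    S.IsQ e := by
  obtain ⟨c', ⟨i⟩⟩ := he
  have := hC.mapH0_full
  have := hC.mapH0_faithful
  have := hC.essSurj
  -- On representable modules `Perf(C)` is `C` followed by Yoneda, both fully faithful on `H⁰`.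
  -- Pretriangulatedness of `S.C` makes Yoneda an equivalence on idempotent completions, so the
  -- property extends to all perfect modules.
  have : (S.C.yoneda.mapH0 ⋙ φ.perfC.mapH0).Full := Functor.Full.of_iso φ.perfIsoH0.symm
  have : (S.C.yoneda.mapH0 ⋙ φ.perfC.mapH0).Faithful := Functor.Faithful.of_iso φ.perfIsoH0.symm
  have := full_of_isEquivalence_idempFunctor S.C.yoneda.mapH0 φ.perfC.mapH0
  have := faithful_of_isEquivalence_idempFunctor S.C.yoneda.mapH0 φ.perfC.mapH0
  let c := φ.C.mapH0.objPreimage (S'.C.h0 c')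
  exact ⟨c.as.as, ⟨φ.perfC.mapH0.preimageIso
    (S'.C.Perf.toH0.mapIso (φ.adjMap.right.app e).symm ≪≫ i ≪≫
      S'.C.yoneda.mapH0.mapIso (φ.C.mapH0.objObjPreimageIso (S'.C.h0 c')).symm ≪≫
      (φ.perfIsoH0.app c).symm)⟩⟩

/-- Full DG subcategories keep their Hom complexes, so injectivity and surjectivity on cohomology
are those of `E`. The content is that a preimage under `E` of an object of `Q` lies in `Q`. -/
lemma Q_isQuasiEquivalence (hC : φ.C.IsQuasiEquivalence) (hE : φ.E.IsQuasiEquivalence) :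
    φ.Q.IsQuasiEquivalence where
  inj f hf h := hE.inj f hf h
  surj g hg := hE.surj g hg
  essSurj := ⟨fun e' => by
    have := hE.essSurj
    let I := (DGFunctor.fullIncl S'.E S'.IsQ).mapH0
    have : I.Full := DGFunctor.fullIncl_full _
    have : I.Faithful := DGFunctor.fullIncl_faithful _
    let e := φ.E.mapH0.objPreimage (I.obj e')
    let j : φ.E.mapH0.obj e ≅ I.obj e' := φ.E.mapH0.objObjPreimageIso (I.obj e')
    have he : S.IsQ e.as.as := by
      refine isQ_of_isQ_obj hC ?_
      obtain ⟨c, ⟨i⟩⟩ := e'.as.as.2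
      -- `G'` preserves homotopy equivalences, so the condition defining `Q` passes from `e'` to `E
      -- e` along `j`.
      exact ⟨c, ⟨S'.G.mapH0.mapIso j ≪≫ i⟩⟩
    exact ⟨S.Q.h0 ⟨e.as.as, he⟩, ⟨I.preimageIso j⟩⟩⟩

end SetupMap

end Restriction

theorem mainTheorem6
    {k : Type w} [CommRing k]
    {𝒞 : Type uc} [Category.{vc} 𝒞] [Limits.HasZeroObject 𝒞] [HasShift 𝒞 ℤ] [Preadditive 𝒞]
    [∀ n : ℤ, (shiftFunctor 𝒞 n).Additive] [Pretriangulated 𝒞] [IsTriangulated 𝒞]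
    {𝒞' : Type uc'} [Category.{vc'} 𝒞'] [Limits.HasZeroObject 𝒞'] [HasShift 𝒞' ℤ] [Preadditive 𝒞']
    [∀ n : ℤ, (shiftFunctor 𝒞' n).Additive] [Pretriangulated 𝒞'] [IsTriangulated 𝒞']
    (M : CategoryTheory.Monad 𝒞) [M.toFunctor.CommShift ℤ] [M.toFunctor.IsTriangulated]
    (M' : CategoryTheory.Monad 𝒞') [M'.toFunctor.CommShift ℤ] [M'.toFunctor.IsTriangulated]
    (S : MonadSetup.{w, u, v, u', v'} k M) (S' : MonadSetup.{w, u₁, v₁, u₁', v₁'} k M')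
    (φ : SetupMap S.toPreSetup S'.toPreSetup) :
    (∃ Γ : S.Q.H0 ⥤ M.Algebra, Γ.IsEquivalence ∧ S.IsRestriction Γ) ∧
    (∃ Γ' : S'.Q.H0 ⥤ M'.Algebra, Γ'.IsEquivalence ∧ S'.IsRestriction Γ') ∧
    (∀ (Γ : S.Q.H0 ⥤ M.Algebra) (Γ' : S'.Q.H0 ⥤ M'.Algebra),
      S.IsRestriction Γ → S'.IsRestriction Γ' →
        Γ.IsEquivalence ∧ Γ'.IsEquivalence ∧
          Nonempty (Γ ⋙ φ.modFunctor ≅ φ.Q.mapH0 ⋙ Γ')) ∧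
    (φ.C.IsQuasiEquivalence → φ.E.IsQuasiEquivalence → φ.Q.IsQuasiEquivalence) := by
  have := S.isEquivalence
  have := S'.isEquivalence
  obtain ⟨Γ₀, h₀⟩ := PreSetup.exists_isRestriction (S := S.toPreSetup)
  obtain ⟨Γ₀', h₀'⟩ := PreSetup.exists_isRestriction (S := S'.toPreSetup)
  exact ⟨⟨Γ₀, h₀.isEquivalence, h₀⟩, ⟨Γ₀', h₀'.isEquivalence, h₀'⟩,
    fun _ _ h h' => ⟨h.isEquivalence, h'.isEquivalence, φ.nonempty_comp_modFunctor_iso h h'⟩,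
    SetupMap.Q_isQuasiEquivalence⟩
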